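/- **Proposition (Gap Between Mean and Peak Age).** Consider a single-server queue with $N$ packet classes. Class-$k$ packets are generated according to a Poisson process with rate $\lambda_k(t)$, and a class-$k$ service has an exponential service time with time-varying rate $\mu_k(t)$; all rates are nonnegative, locally integrable and periodic with a common period, the $\mu_k$ may vanish during outages, and all these processes are independent of each other and of the initial situation. Each class has a buffer of size one in which a newly arriving packet replaces the waiting one; a packet arriving at an idle server enters service at once; service is non-preemptive, and at each service completion the server takes the waiting packet of the nonempty class of smallest index (and clears its buffer), or becomes idle if there is none. The system starts at time $0$ from an arbitrary (possibly random) state in which, for each class, an update has already been delivered, the freshest one having an age of finite mean. Let $J(t)$ be the class in service at time $t$ (with $J(t)=0$ if the server is idle), let $\Delta_i(t)=t-\max\{r_n^{(i)}:C_n^{(i)}\le t\}$ be the age of class $i$, where $r_n^{(i)}$ and $C_n^{(i)}$ are the generation and completion times of its delivered updates, and put $\Delta_i^-(t)=\lim_{k\to0^-}\Delta_i(t+k)$. Let $$\bar\Delta_i(t)=\mathbb E[\Delta_i(t)],\quad \pi_i(t)=P\{J(t)=i\},\quad \Delta_i^c(t)=\mathbb E[\Delta_i(t)\mid J(t)\ne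 i],\quad \hat\Delta_i(t)=\lim_{h\to0^+}\mathbb E[\Delta_i^-(t)\mid\mathcal E_i(t,t+h)],$$ where $\mathcal E_i(t,t+h)$ is the event that a class-$i$ completion occurs in $(t,t+h)$. Let $t>0$ and let $i$ be a class with $P(\mathcal E_i(t,t+h))>0$ for all $h>0$. Then $\Delta_i(t)$ and $\Delta_i^-(t)$ are integrable, the limit $\hat\Delta_i(t)$ exists if $\pi_i(t)>0$, and whenever this limit exists, $$\hat\Delta_i(t)-\bar\Delta_i(t)=(1-\pi_i(t))\,\bigl(\hat\Delta_i(t)-\Delta_i^c(t)\bigr)$$ (if $\pi_i(t)=1$, so that $\Delta_i^c(t)$ is undefined, the right-hand side is read as $0$). Moreover, the mean peak age can fall below the mean age: there are such a system, a class $i$ and a time $t>0$ with $P(\mathcal E_i(t,t+h))>0$ for all $h>0$ and $\pi_i(t)>0$, for which $\hat\Delta_i(t)<\bar\Delta_i(t)$. -/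

import Mathlib

open MeasureTheory ProbabilityTheory Set Filter Topology
open scoped NNReal ENNReal

noncomputable section

namespace AgeQueue

/-! ### Discrete dynamics of the priority queue -/

/-- State of the system with `N` classes (a smaller index means a higher priority).  Either the
server is idle (and then all the buffers are empty), or the server is serving a packet of class `j`
generated at time `r`, and `buf k` is the generation time of the packet waiting in the size-one
buffer of class `k` (`none` if that buffer is empty). -/
inductive QState (N : ℕ) : Type
  | idle : QState N
  | busy (j : Fin N) (r : ℝ) (buf : Fin N → Option ℝ) : QState N

namespace QState

variable {N : ℕ}

/-- The class in service, `none` for an idle server. -/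
def serving : QState N → Option (Fin N)
  | idle => none
  | busy j _ _ => some j

/-- Generation time of the packet in service (`0` if the server is idle). -/
def servGen : QState N → ℝ
  | idle => 0
  | busy _ r _ => r

/-- Is a packet waiting in the class-`k` buffer? -/
def waiting (k : Fin N) : QState N → Bool
  | idle => false
  | busy _ _ buf => (buf k).isSome

/-- Generation time of the packet waiting in the class-`k` buffer (`0` if there is none). -/
def bufGen (k : Fin N) : QState N → ℝ
  | idle => 0
  | busy _ _ buf => (buf k).getD 0

/-- The σ-algebra on states generated by the coordinates. -/
instance : MeasurableSpace (QState N) :=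
  MeasurableSpace.comap serving ⊤ ⊔ MeasurableSpace.comap servGen inferInstance ⊔
    (⨆ k, MeasurableSpace.comap (waiting k) ⊤) ⊔
    (⨆ k, MeasurableSpace.comap (bufGen k) inferInstance)

/-- A class-`k` packet generated at time `τ` arrives: it enters service if the server is idle;
otherwise it goes to the class-`k` buffer, replacing the packet that waits there, if any. -/
def arrive (k : Fin N) (τ : ℝ) : QState N → QState N
  | idle => busy k τ fun _ => none
  | busy j r buf => busy j r (Function.update buf k (some τ))

open Classical in
/-- The server becomes free while the buffers are `buf`: the waiting packet of the nonempty class of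
smallest index enters service and its buffer is cleared; if all buffers are empty the server
becomes idle. -/
def startNext (buf : Fin N → Option ℝ) : QState N :=
  if h : (Finset.univ.filter fun k => buf k ≠ none).Nonempty then
    let k := (Finset.univ.filter fun k => buf k ≠ none).min' h
    busy k ((buf k).getD 0) (Function.update buf k none)
  else idle

/-- A point of the class-`k` service clock: the service in progress is completed if it is a service
of class `k`; otherwise nothing happens. -/
def complete (k : Fin N) : QState N → QState N
  | idle => idle
  | busy j r buf => if j = k then startNext buf else busy j r buf

end QState

/-! ### Rates and Poisson clocks -/

/-- Arrival rates `arr k` and nominal service rates `svc k` of the `N` classes: nonnegative, locally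
integrable functions of time with a common period. A service rate vanishes during outages. -/
structure Rates (N : ℕ) where
  arr : Fin N → ℝ → ℝ
  svc : Fin N → ℝ → ℝ
  period : ℝ
  period_pos : 0 < period
  arr_nonneg : ∀ k t, 0 ≤ arr k t
  svc_nonneg : ∀ k t, 0 ≤ svc k t
  arr_periodic : ∀ k, Function.Periodic (arr k) period
  svc_periodic : ∀ k, Function.Periodic (svc k) period
  arr_integrable : ∀ k, LocallyIntegrable (arr k) volume
  svc_integrable : ∀ k, LocallyIntegrable (svc k) volume

/-- The random clocks of the system: one arrival clock and one service clock per class. -/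
inductive Clock (N : ℕ) : Type
  | arrival (k : Fin N) : Clock N
  | service (k : Fin N) : Clock N

/-- The rate of a clock. -/
def Rates.rate {N : ℕ} (R : Rates N) : Clock N → ℝ → ℝ
  | .arrival k => R.arr k
  | .service k => R.svc k

/-- The effect on the state of a point of the clock `c` at time `τ`. -/
def Clock.act {N : ℕ} (τ : ℝ) : Clock N → QState N → QState N
  | .arrival k => QState.arrive k τ
  | .service k => QState.complete k

/-- The number of points in `(0, t]` of a random set of times. -/
def count {Ω : Type*} (pts : Ω → Set ℝ) (t : ℝ≥0) (ω : Ω) : ℕ :=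
  (pts ω ∩ Ioc 0 (t : ℝ)).ncard

/-- The random locally finite set `pts` of positive times is an (inhomogeneous) Poisson process with
rate function `r`: the counting process has independent increments, and the number of points in
`(s, t]` has the Poisson law of parameter `∫ u in s..t, r u`. -/
structure IsPoissonProcess {Ω : Type*} [MeasurableSpace Ω] (P : Measure Ω)
    (pts : Ω → Set ℝ) (r : ℝ → ℝ) : Prop where
  pos : ∀ ω, pts ω ⊆ Ioi 0
  locallyFinite : ∀ ω T, (pts ω ∩ Ioc 0 T).Finite
  measurable_count : ∀ t, Measurable (count pts t)
  law : ∀ s t : ℝ≥0, s ≤ t →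
    P.map (fun ω => count pts t ω - count pts s ω)
      = poissonMeasure (∫ u in (s : ℝ)..(t : ℝ), r u).toNNReal
  indep : HasIndepIncrements (count pts) P

/-! ### The queueing system -/

/-- The random data that drive the queueing system on the probability space `(Ω, P)`.

* Class-`k` packets are generated at the points of a Poisson process of rate `R.arr k`.
* A service of class `k` that is in progress is completed at the first point, after the start of the
  service, of a Poisson process of rate `R.svc k`; in other words service times are
  exponential with the time-varying rate `R.svc k` (hazard rate `R.svc k u` at time `u`).
* All these processes are independent, and independent of the situation at time `0`; no two of
  them have a common point (this excludes only a null event).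
* The situation at time `0` is arbitrary: a random state `init`, and for each class `i` the generation
  time `lastGen · i ≤ 0` of the freshest update of class `i` delivered by time `0`. -/
structure PriorityQueue {Ω : Type*} [MeasurableSpace Ω] (P : Measure Ω) {N : ℕ} (R : Rates N) where
  points : Clock N → Ω → Set ℝ
  poisson : ∀ c, IsPoissonProcess P (points c) (R.rate c)
  points_disjoint : ∀ ω c c', c ≠ c' → Disjoint (points c ω) (points c' ω)
  init : Ω → QState N
  lastGen : Ω → Fin N → ℝ
  measurable_init : Measurable init
  measurable_lastGen : Measurable lastGen
  servGen_nonpos : ∀ ω, (init ω).servGen ≤ 0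
  bufGen_nonpos : ∀ ω k, (init ω).bufGen k ≤ 0
  lastGen_nonpos : ∀ ω i, lastGen ω i ≤ 0
  integrable_lastGen : ∀ i, Integrable (fun ω => lastGen ω i) P
  indep_clocks : iIndepFun (fun c ω (t : ℝ≥0) => count (points c) t ω) P
  indep_init : IndepFun (fun ω => (init ω, lastGen ω))
    (fun ω (c : Clock N) (t : ℝ≥0) => count (points c) t ω) P

namespace PriorityQueue

variable {Ω : Type*} [MeasurableSpace Ω] {P : Measure Ω} {N : ℕ} {R : Rates N}
  (Q : PriorityQueue P R)

/-- The times in the time set `I` at which some clock has a point. -/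
def eventTimes (ω : Ω) (I : Set ℝ) : Set ℝ := {τ | τ ∈ I ∧ ∃ c, τ ∈ Q.points c ω}

theorem finite_eventTimes (ω : Ω) {I : Set ℝ} {T : ℝ} (hI : I ⊆ Ioc 0 T) :
    (Q.eventTimes ω I).Finite := by
  have hC : Finite (Clock N) :=
    Finite.of_injective
      (fun c : Clock N => (match c with
        | .arrival k => Sum.inl k
        | .service k => Sum.inr k : Fin N ⊕ Fin N))
      (by rintro (a | a) (b | b) h <;> simp_all)
  refine (Set.finite_iUnion fun c => (Q.poisson c).locallyFinite ω T).subset ?_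
  rintro τ ⟨hτ, c, hc⟩
  exact Set.mem_iUnion.2 ⟨c, hc, hI hτ⟩

open Classical in
/-- Effect on the state of the (unique) clock that has a point at time `τ`. -/
def actAt (ω : Ω) (s : QState N) (τ : ℝ) : QState N :=
  if h : ∃ c, τ ∈ Q.points c ω then h.choose.act τ s else s

/-- The state obtained from the initial one by processing, in chronological order, all the events
in a finite set of times. -/
def runOver (ω : Ω) (S : Finset ℝ) : QState N :=
  (S.sort (· ≤ ·)).foldl (Q.actAt ω) (Q.init ω)

/-- The state at time `t`. -/
def state (t : ℝ) (ω : Ω) : QState N :=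
  Q.runOver ω (Q.finite_eventTimes ω (Subset.refl (Ioc 0 t))).toFinset

/-- The state just before time `t`. -/
def stateBefore (t : ℝ) (ω : Ω) : QState N :=
  Q.runOver ω (Q.finite_eventTimes ω (I := Ioo 0 t) Ioo_subset_Ioc_self).toFinset

/-- The pairs `(r, C)` such that a packet of class `i` generated at time `r` completes its service
at time `C > 0`. -/
def completions (i : Fin N) (ω : Ω) : Set (ℝ × ℝ) :=
  {x | x.2 ∈ Q.points (.service i) ω ∧ (Q.stateBefore x.2 ω).serving = some i ∧
    (Q.stateBefore x.2 ω).servGen = x.1}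

/-- The pairs (generation time, delivery time) of the delivered updates of class `i`, including the
freshest one delivered by time `0`. -/
def deliveries (i : Fin N) (ω : Ω) : Set (ℝ × ℝ) :=
  insert (Q.lastGen ω i, 0) (Q.completions i ω)

/-- The Age of Information `Δ_i(t) = t - max {r_n : C_n ≤ t}`. -/
def age (i : Fin N) (t : ℝ) (ω : Ω) : ℝ :=
  t - sSup {r | ∃ C ≤ t, (r, C) ∈ Q.deliveries i ω}

/-- The left limit `Δ_i⁻(t)` of the age at time `t`. -/
def ageLeft (i : Fin N) (t : ℝ) (ω : Ω) : ℝ :=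
  Function.leftLim (fun s => Q.age i s ω) t

/-- The event that a class-`i` completion occurs in `(t, u)`. -/
def completionEvent (i : Fin N) (t u : ℝ) : Set Ω :=
  {ω | ∃ x ∈ Q.completions i ω, x.2 ∈ Ioo t u}

/-- The event that class `i` is in service at time `t`. -/
def inService (i : Fin N) (t : ℝ) : Set Ω := {ω | (Q.state t ω).serving = some i}

/-- The probability `π_i(t)` that class `i` is in service at time `t`. -/
def serviceProb (i : Fin N) (t : ℝ) : ℝ := P.real (Q.inService i t)

/-- The mean age `E[Δ_i(t)]`. -/
def meanAge (i : Fin N) (t : ℝ) : ℝ := ∫ ω, Q.age i t ω ∂P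

/-- The unserved mean age `E[Δ_i(t) | J(t) ≠ i]`. -/
def unservedMeanAge (i : Fin N) (t : ℝ) : ℝ :=
  ∫ ω, Q.age i t ω ∂(ProbabilityTheory.cond P (Q.inService i t)ᶜ)

/-- `d` is the mean peak age of class `i` at time `t`: the limit as `h → 0⁺` of
`E[Δ_i⁻(t) | a class-i completion occurs in (t, t + h)]`. -/
def HasMeanPeakAge (i : Fin N) (t d : ℝ) : Prop :=
  Tendsto (fun h : ℝ => ∫ ω, Q.ageLeft i t ω
    ∂(ProbabilityTheory.cond P (Q.completionEvent i t (t + h)))) (𝓝[>] 0) (𝓝 d)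

end PriorityQueue

end AgeQueue

end

/-!
The gap formula rests on one fact: the mean peak age of class `i` at time `t` is the mean age given
that class `i` is in service at time `t` (`PriorityQueue.hasMeanPeakAge`). If class `i` is in
service at time `t`, a class-`i` completion in `(t, u)` occurs exactly when the class-`i` service
clock has a point there (`PriorityQueue.completionEvent_iff_of_serving`). If it is not in service,
such a completion needs a point of some other clock too, because a class-`i` service must start
first (`PriorityQueue.exists_other_clock_of_completion`); two clocks having points in `(t, u]` has
probability of smaller order. The points after `t` are independent of the past, and the state and
the age at time `t` belong to the past, so the probability `a(u)` of a point of the service clock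
factors out: the contribution of the completion event to the mean age is `a(u) (E[Δ; J = i] +
o(1))`, and its probability is `a(u) (π + o(1))`
(`PriorityQueue.tendsto_setIntegral_completionEvent_div`). The quotient tends to `E[Δ | J = i]`. No
continuity of the rates is needed, only that `a(u)` is positive, which the hypothesis on the
completion event provides. The gap formula is then the law of total expectation, and the left limit
of the age may be replaced by the age since a Poisson clock has almost surely no point at `t`.

The measurability of the state and of the age with respect to the past is obtained by letting the
events act at the end points of the cells of a fine time grid, where they are functions of the
counting processes. Generation times are only copied, never combined, so the error does not exceed
the mesh once the grid separates the events (`PriorityQueue.measurable_state_fresh`). The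
independence of the past and the future is deduced from the independent increments of each clock
(`PriorityQueue.indepFun_pastMap_increments`).

For the peak age below the mean age there is one class, with arrivals at rate `1` in `[0, 1)`,
service at rate `10` in `[1, 3)`, period `3`, an idle server at time `0`, and a last update of
initial age `10`; the time is `t = 2`. With probability `e⁻¹` there is no arrival, and then the age
is `12`; so the mean age exceeds `4` (`four_lt_meanAge`). If the server is busy at time `2`, the
age is at most `2` unless the service clock has been silent, and the latter is at most one fifth as
likely as the server being busy; so the mean peak age is at most `4`
(`setIntegral_age_inService_le`). The clocks themselves are constructed by placing, in each unit
cell of the half-line, a Poisson number of independent points distributed according to the rate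
(`isPoissonProcess_poissonPoints`). Campbell's formula (`integral_prod_points`) gives the joint law
of the increments.
-/

namespace AgeQueue

/-! ### Runs of the queue over a time interval -/

instance (N : ℕ) : Finite (Clock N) :=
  Finite.of_injective
    (fun c : Clock N => (match c with
      | .arrival k => Sum.inl k
      | .service k => Sum.inr k : Fin N ⊕ Fin N))
    (by rintro (a | a) (b | b) h <;> simp_all)

theorem sort_union_of_lt {S T : Finset ℝ} (h : ∀ a ∈ S, ∀ b ∈ T, a < b) :
    (S ∪ T).sort (· ≤ ·) = S.sort (· ≤ ·) ++ T.sort (· ≤ ·) := by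
  have hd : Disjoint S T := Finset.disjoint_left.2 fun a ha hb => lt_irrefl _ (h a ha a hb)
  refine List.Perm.eq_of_pairwise (le := (· ≤ ·)) (fun a b _ _ => le_antisymm)
    (Finset.pairwise_sort _ _) ?_ ?_
  · refine List.pairwise_append.2 ⟨Finset.pairwise_sort _ _, Finset.pairwise_sort _ _, ?_⟩
    intro a ha b hb
    exact (h a (by simpa using ha) b (by simpa using hb)).le
  · refine (List.perm_ext_iff_of_nodup (Finset.sort_nodup _ _) ?_).2 fun a => by simp
    refine List.nodup_append.2 ⟨Finset.sort_nodup _ _, Finset.sort_nodup _ _, ?_⟩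
    intro a ha b hb
    exact (h a (by simpa using ha) b (by simpa using hb)).ne

namespace PriorityQueue

variable {Ω : Type*} [MeasurableSpace Ω] {P : Measure Ω} {N : ℕ} {R : Rates N}
  (Q : PriorityQueue P R)

/-- Clocks have no common points, so at an event time only one clock can act. -/
theorem actAt_eq {ω : Ω} {τ : ℝ} {c : Clock N} (hc : τ ∈ Q.points c ω) (x : QState N) :
    Q.actAt ω x τ = c.act τ x := by
  have h : ∃ c, τ ∈ Q.points c ω := ⟨c, hc⟩
  have : h.choose = c := by
    by_contra hne
    exact Set.disjoint_left.1 (Q.points_disjoint ω _ _ hne) h.choose_spec hc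
  simp only [actAt, dif_pos h, this]

theorem runOver_union (ω : Ω) {S T : Finset ℝ} (h : ∀ a ∈ S, ∀ b ∈ T, a < b) :
    Q.runOver ω (S ∪ T) = (T.sort (· ≤ ·)).foldl (Q.actAt ω) (Q.runOver ω S) := by
  simp only [runOver, sort_union_of_lt h, List.foldl_append]

/-- The state at time `u` is the result of processing the events in `(s, u]` from the state at time
`s`. -/
theorem exists_foldl_state (ω : Ω) {s u : ℝ} (hs : 0 ≤ s) (hsu : s ≤ u) :
    ∃ l : List ℝ, (∀ τ, τ ∈ l ↔ τ ∈ Q.eventTimes ω (Ioc s u)) ∧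
      Q.state u ω = l.foldl (Q.actAt ω) (Q.state s ω) := by
  have hf : (Q.eventTimes ω (Ioc s u)).Finite :=
    Q.finite_eventTimes ω (Ioc_subset_Ioc_left hs)
  refine ⟨hf.toFinset.sort (· ≤ ·), by simp, ?_⟩
  rw [state, state, ← runOver_union]
  · congr 1
    ext τ
    simp only [eventTimes, mem_Ioc, Finite.mem_toFinset, mem_ofPred_eq, Finset.mem_union]
    constructor
    · rintro ⟨⟨h1, h2⟩, h3⟩
      rcases le_or_gt τ s with h | h
      · exact Or.inl ⟨⟨h1, h⟩, h3⟩
      · exact Or.inr ⟨⟨h, h2⟩, h3⟩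
    · rintro (⟨⟨h1, h2⟩, h3⟩ | ⟨⟨h1, h2⟩, h3⟩)
      · exact ⟨⟨h1, h2.trans hsu⟩, h3⟩
      · exact ⟨⟨hs.trans_lt h1, h2⟩, h3⟩
  · intro a ha b hb
    simp only [eventTimes, mem_Ioc, Finite.mem_toFinset, mem_ofPred_eq] at ha hb
    exact ha.1.2.trans_lt hb.1.1

theorem exists_foldl_stateBefore (ω : Ω) {s u : ℝ} (hs : 0 ≤ s) (hsu : s < u) :
    ∃ l : List ℝ, (∀ τ, τ ∈ l ↔ τ ∈ Q.eventTimes ω (Ioo s u)) ∧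
      Q.stateBefore u ω = l.foldl (Q.actAt ω) (Q.state s ω) := by
  have hf : (Q.eventTimes ω (Ioo s u)).Finite :=
    Q.finite_eventTimes ω (Ioo_subset_Ioc_self.trans (Ioc_subset_Ioc_left hs))
  refine ⟨hf.toFinset.sort (· ≤ ·), by simp, ?_⟩
  rw [stateBefore, state, ← runOver_union]
  · congr 1
    ext τ
    simp only [eventTimes, mem_Ioc, mem_Ioo, Finite.mem_toFinset, mem_ofPred_eq, Finset.mem_union]
    constructor
    · rintro ⟨⟨h1, h2⟩, h3⟩
      rcases le_or_gt τ s with h | h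
      · exact Or.inl ⟨⟨h1, h⟩, h3⟩
      · exact Or.inr ⟨⟨h, h2⟩, h3⟩
    · rintro (⟨⟨h1, h2⟩, h3⟩ | ⟨⟨h1, h2⟩, h3⟩)
      · exact ⟨⟨h1, h2.trans_lt hsu⟩, h3⟩
      · exact ⟨⟨hs.trans_lt h1, h2⟩, h3⟩
  · intro a ha b hb
    simp only [eventTimes, mem_Ioc, mem_Ioo, Finite.mem_toFinset, mem_ofPred_eq] at ha hb
    exact ha.1.2.trans_lt hb.1.1

@[simp] theorem state_zero (ω : Ω) : Q.state 0 ω = Q.init ω := by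
  have : (Q.finite_eventTimes ω (Subset.refl (Ioc 0 0))).toFinset = ∅ := by
    ext τ; simp [eventTimes]
  rw [state, runOver, this]
  simp

theorem foldl_actAt_induction {ω : Ω} {I : Set ℝ} (p : QState N → Prop)
    (hact : ∀ c τ x, τ ∈ Q.points c ω → τ ∈ I → p x → p (c.act τ x)) (l : List ℝ)
    (hl : ∀ τ ∈ l, τ ∈ Q.eventTimes ω I) {x : QState N} (hx : p x) :
    p (l.foldl (Q.actAt ω) x) := by
  induction l generalizing x with
  | nil => simpa
  | cons τ l ih =>
    obtain ⟨hτ, c, hc⟩ := hl τ (by simp)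
    refine ih (fun τ' h' => hl τ' (by simp [h'])) ?_
    rw [Q.actAt_eq hc]
    exact hact c τ x hc hτ hx

/-- A property that holds at time `s` and is preserved by the events in `(s, u]` holds at time `u`.
-/
theorem state_induction {ω : Ω} {s u : ℝ} (hs : 0 ≤ s) (hsu : s ≤ u) (p : QState N → Prop)
    (h0 : p (Q.state s ω))
    (hact : ∀ c τ x, τ ∈ Q.points c ω → τ ∈ Ioc s u → p x → p (c.act τ x)) :
    p (Q.state u ω) := by
  obtain ⟨l, hl, he⟩ := Q.exists_foldl_state ω hs hsu
  rw [he]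
  exact Q.foldl_actAt_induction p hact l (fun τ h => (hl τ).1 h) h0

theorem stateBefore_induction {ω : Ω} {s u : ℝ} (hs : 0 ≤ s) (hsu : s < u)
    (p : QState N → Prop) (h0 : p (Q.state s ω))
    (hact : ∀ c τ x, τ ∈ Q.points c ω → τ ∈ Ioo s u → p x → p (c.act τ x)) :
    p (Q.stateBefore u ω) := by
  obtain ⟨l, hl, he⟩ := Q.exists_foldl_stateBefore ω hs hsu
  rw [he]
  exact Q.foldl_actAt_induction p hact l (fun τ h => (hl τ).1 h) h0

theorem state_eq_of_forall_notMem {ω : Ω} {s u : ℝ} (hs : 0 ≤ s) (hsu : s ≤ u)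
    (h : ∀ c, ∀ τ ∈ Q.points c ω, τ ∉ Ioc s u) : Q.state u ω = Q.state s ω :=
  Q.state_induction hs hsu (· = Q.state s ω) rfl fun c τ _ hc hτ => absurd hτ (h c τ hc)

theorem stateBefore_eq_of_forall_notMem {ω : Ω} {s u : ℝ} (hs : 0 ≤ s) (hsu : s < u)
    (h : ∀ c, ∀ τ ∈ Q.points c ω, τ ∉ Ioo s u) : Q.stateBefore u ω = Q.state s ω :=
  Q.stateBefore_induction hs hsu (· = Q.state s ω) rfl fun c τ _ hc hτ => absurd hτ (h c τ hc)

/-- The state at an event time is obtained from the state just before it. -/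
theorem state_eq_act_stateBefore {ω : Ω} {τ : ℝ} {c : Clock N} (hτ : τ ∈ Q.points c ω) :
    Q.state τ ω = c.act τ (Q.stateBefore τ ω) := by
  have hpos : 0 < τ := (Q.poisson c).pos ω hτ
  have h : (Q.finite_eventTimes ω (Subset.refl (Ioc 0 τ))).toFinset =
      (Q.finite_eventTimes ω (I := Ioo 0 τ) Ioo_subset_Ioc_self).toFinset ∪ {τ} := by
    ext σ
    simp only [eventTimes, mem_Ioc, mem_Ioo, Finite.mem_toFinset, mem_ofPred_eq, Finset.mem_union,
      Finset.mem_singleton]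
    constructor
    · rintro ⟨⟨h1, h2⟩, h3⟩
      rcases h2.lt_or_eq with h | h
      · exact Or.inl ⟨⟨h1, h⟩, h3⟩
      · exact Or.inr h
    · rintro (⟨⟨h1, h2⟩, h3⟩ | rfl)
      · exact ⟨⟨h1, h2.le⟩, h3⟩
      · exact ⟨⟨hpos, le_rfl⟩, c, hτ⟩
  rw [state, h, runOver_union]
  · simp [stateBefore, Q.actAt_eq hτ]
  · intro a ha b hb
    simp only [eventTimes, mem_Ioo, Finite.mem_toFinset, mem_ofPred_eq, Finset.mem_singleton]
      at ha hb
    exact hb ▸ ha.1.2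

/-! ### The freshest delivered update -/

/-- The generation time of the freshest update of class `i` delivered by time `t`. -/
noncomputable def fresh (i : Fin N) (t : ℝ) (ω : Ω) : ℝ :=
  sSup {r | ∃ C ≤ t, (r, C) ∈ Q.deliveries i ω}

theorem age_eq_sub_fresh (i : Fin N) (t : ℝ) (ω : Ω) : Q.age i t ω = t - Q.fresh i t ω := rfl

theorem delivered_finite (i : Fin N) (t : ℝ) (ω : Ω) :
    {r | ∃ C ≤ t, (r, C) ∈ Q.deliveries i ω}.Finite := by
  have hf := (Q.poisson (.service i)).locallyFinite ω t
  refine ((hf.image fun C => (Q.stateBefore C ω).servGen).insert (Q.lastGen ω i)).subset ?_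
  rintro r ⟨C, hC, h | h⟩
  · exact Or.inl (Prod.ext_iff.1 h).1
  · exact Or.inr ⟨C, ⟨h.1, (Q.poisson _).pos ω h.1, hC⟩, h.2.2⟩

theorem le_fresh {i : Fin N} {t : ℝ} {ω : Ω} {r C : ℝ} (hC : C ≤ t)
    (h : (r, C) ∈ Q.deliveries i ω) : r ≤ Q.fresh i t ω :=
  le_csSup (Q.delivered_finite i t ω).bddAbove ⟨C, hC, h⟩

theorem lastGen_le_fresh {i : Fin N} {t : ℝ} (ht : 0 ≤ t) (ω : Ω) :
    Q.lastGen ω i ≤ Q.fresh i t ω :=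
  Q.le_fresh ht (mem_insert _ _)

theorem fresh_mono (i : Fin N) {s t : ℝ} (hs : 0 ≤ s) (hst : s ≤ t) (ω : Ω) :
    Q.fresh i s ω ≤ Q.fresh i t ω :=
  csSup_le_csSup (Q.delivered_finite i t ω).bddAbove
    ⟨_, 0, hs, mem_insert _ _⟩ fun _ ⟨C, hC, h⟩ => ⟨C, hC.trans hst, h⟩

theorem fresh_le {i : Fin N} {t : ℝ} {ω : Ω} {b : ℝ} (ht : 0 ≤ t) (h0 : Q.lastGen ω i ≤ b)
    (h : ∀ x ∈ Q.completions i ω, x.2 ≤ t → x.1 ≤ b) : Q.fresh i t ω ≤ b := by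
  refine csSup_le ⟨_, 0, ht, mem_insert _ _⟩ ?_
  rintro r ⟨C, hC, h1 | h1⟩
  · exact (Prod.ext_iff.1 h1).1.trans_le h0
  · exact h _ h1 hC

theorem fresh_zero (i : Fin N) (ω : Ω) : Q.fresh i 0 ω = Q.lastGen ω i := by
  refine le_antisymm (Q.fresh_le le_rfl le_rfl ?_) (Q.lastGen_le_fresh le_rfl ω)
  intro x hx h
  exact absurd ((Q.poisson _).pos ω hx.1) (not_lt.2 h)

theorem fresh_eq_of_forall_notMem {i : Fin N} {s u : ℝ} {ω : Ω} (hs : 0 ≤ s) (hsu : s ≤ u)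
    (h : ∀ x ∈ Q.completions i ω, x.2 ∉ Ioc s u) : Q.fresh i u ω = Q.fresh i s ω := by
  refine le_antisymm (Q.fresh_le (hs.trans hsu) (Q.lastGen_le_fresh hs ω) ?_)
    (Q.fresh_mono i hs hsu ω)
  intro x hx hxu
  refine Q.le_fresh (C := x.2) (not_lt.1 fun h' => h x hx ⟨h', hxu⟩) (Or.inr hx)

/-- If a service of class `i` is completed at the only point `τ` of its service clock in `(s, u]`,
the freshest update is the better one of the old one and the packet in service just before `τ`. -/
theorem fresh_eq_max {i : Fin N} {s u τ : ℝ} {ω : Ω} (hs : 0 ≤ s) (hτ : τ ∈ Ioc s u)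
    (hc : τ ∈ Q.points (.service i) ω) (hi : (Q.stateBefore τ ω).serving = some i)
    (h : ∀ σ ∈ Q.points (.service i) ω, σ ∈ Ioc s u → σ = τ) :
    Q.fresh i u ω = max (Q.fresh i s ω) (Q.stateBefore τ ω).servGen := by
  have hsu : s ≤ u := hτ.1.le.trans hτ.2
  refine le_antisymm (Q.fresh_le (hs.trans hsu)
    ((Q.lastGen_le_fresh hs ω).trans (le_max_left _ _)) ?_) (max_le (Q.fresh_mono i hs hsu ω) ?_)
  · intro x hx hxu
    rcases le_or_gt x.2 s with h' | h'
    · exact (Q.le_fresh h' (Or.inr hx)).trans (le_max_left _ _)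
    · rw [← h x.2 hx.1 ⟨h', hxu⟩, hx.2.2]
      exact le_max_right _ _
  · exact Q.le_fresh hτ.2 (Or.inr ⟨hc, hi, rfl⟩)

end PriorityQueue

/-! ### Generation times do not exceed the current time -/

namespace QState

variable {N : ℕ}

/-- All the packets in the system were generated by time `t`. -/
def GenLE (t : ℝ) (x : QState N) : Prop := x.servGen ≤ t ∧ ∀ k, x.bufGen k ≤ t

theorem startNext_genLE {t : ℝ} (ht : 0 ≤ t) {buf : Fin N → Option ℝ}
    (h : ∀ k, (buf k).getD 0 ≤ t) : GenLE t (startNext buf) := by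
  unfold startNext
  split
  · refine ⟨h _, fun k => ?_⟩
    simp only [bufGen, Function.update_apply]
    split
    · simpa using ht
    · exact h k
  · exact ⟨ht, fun k => ht⟩

theorem GenLE.act {t τ : ℝ} (ht : 0 ≤ t) (hτ : τ ≤ t) (c : Clock N) {x : QState N}
    (hx : GenLE t x) : GenLE t (c.act τ x) := by
  cases c with
  | arrival k =>
    cases x with
    | idle => exact ⟨hτ, fun k => by simpa [Clock.act, arrive, bufGen] using ht⟩
    | busy j r buf =>
      refine ⟨hx.1, fun k' => ?_⟩
      simp only [Clock.act, arrive, bufGen, Function.update_apply]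
      split
      · simpa using hτ
      · exact hx.2 k'
  | service k =>
    cases x with
    | idle => exact hx
    | busy j r buf =>
      simp only [Clock.act, complete]
      split
      · exact startNext_genLE ht hx.2
      · exact hx

end QState

namespace PriorityQueue

variable {Ω : Type*} [MeasurableSpace Ω] {P : Measure Ω} {N : ℕ} {R : Rates N}
  (Q : PriorityQueue P R)

theorem genLE_stateBefore {t : ℝ} (ht : 0 < t) (ω : Ω) : (Q.stateBefore t ω).GenLE t := by
  refine Q.stateBefore_induction le_rfl ht (QState.GenLE t) ?_
    fun c τ x _ hτ hx => hx.act ht.le hτ.2.le c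
  rw [state_zero]
  exact ⟨(Q.servGen_nonpos ω).trans ht.le, fun k => (Q.bufGen_nonpos ω k).trans ht.le⟩

theorem fresh_le_self {i : Fin N} {t : ℝ} (ht : 0 ≤ t) (ω : Ω) : Q.fresh i t ω ≤ t := by
  refine Q.fresh_le ht ((Q.lastGen_nonpos ω i).trans ht) fun x hx hxt => ?_
  rw [← hx.2.2]
  exact (Q.genLE_stateBefore ((Q.poisson _).pos ω hx.1) ω).1.trans hxt

theorem age_nonneg {i : Fin N} {t : ℝ} (ht : 0 ≤ t) (ω : Ω) : 0 ≤ Q.age i t ω :=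
  sub_nonneg.2 (Q.fresh_le_self ht ω)

theorem age_le {i : Fin N} {t : ℝ} (ht : 0 ≤ t) (ω : Ω) : Q.age i t ω ≤ t - Q.lastGen ω i :=
  sub_le_sub_left (Q.lastGen_le_fresh ht ω) t

/-- Without a completion at time `t` the age is continuous from the left at `t`. -/
theorem ageLeft_eq_age {i : Fin N} {t : ℝ} (ht : 0 < t) {ω : Ω}
    (h : t ∉ Q.points (.service i) ω) : Q.ageLeft i t ω = Q.age i t ω := by
  refine leftLim_eq_of_tendsto ?_
  have hf := ((Q.poisson (.service i)).locallyFinite ω t)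
  have hev : ∀ᶠ s in 𝓝[<] t, ∀ τ ∈ Q.points (.service i) ω ∩ Ioc 0 t, τ ≤ s := by
    rw [hf.eventually_all]
    rintro τ ⟨h1, -, h2⟩
    have : τ < t := h2.lt_of_ne (by rintro rfl; exact h h1)
    filter_upwards [Ioo_mem_nhdsLT this] with s hs using hs.1.le
  have hev0 : ∀ᶠ s in 𝓝[<] t, s ∈ Ioo 0 t := Ioo_mem_nhdsLT ht
  have hlim : Tendsto (fun s => s - Q.fresh i t ω) (𝓝[<] t) (𝓝 (t - Q.fresh i t ω)) :=
    ((continuous_id.sub continuous_const).tendsto t).mono_left nhdsWithin_le_nhds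
  refine hlim.congr' ?_
  filter_upwards [hev, hev0] with s hs hs0
  rw [age_eq_sub_fresh, Q.fresh_eq_of_forall_notMem hs0.1.le hs0.2.le]
  intro x hx hxs
  exact absurd (hs x.2 ⟨hx.1, hs0.1.trans hxs.1, hxs.2⟩) (not_le.2 hxs.1)

/-! ### Completions after time `t` -/

theorem act_eq_self_of_serving_ne {i : Fin N} {c : Clock N} {τ : ℝ} {x : QState N}
    (hc : c = .service i) (hx : x.serving ≠ some i) : c.act τ x = x := by
  subst hc
  cases x with
  | idle => rfl
  | busy j r buf =>
    have : j ≠ i := fun h => hx (by simp [QState.serving, h])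
    simp [Clock.act, QState.complete, this]

theorem serving_act_of_serving_eq {i : Fin N} {c : Clock N} {τ : ℝ} {x : QState N}
    (hc : c ≠ .service i) (hx : x.serving = some i) : (c.act τ x).serving = some i := by
  cases x with
  | idle => simp [QState.serving] at hx
  | busy j r buf =>
    simp only [QState.serving, Option.some.injEq] at hx
    subst hx
    cases c with
    | arrival k => rfl
    | service k =>
      have : j ≠ k := fun h => hc (by rw [h])
      simp [Clock.act, QState.complete, this, QState.serving]

/-- If class `i` is in service at time `t`, its next completion is the next point of its service
clock. -/
theorem completionEvent_iff_of_serving {i : Fin N} {t u : ℝ} (ht : 0 ≤ t) {ω : Ω}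
    (hi : (Q.state t ω).serving = some i) :
    ω ∈ Q.completionEvent i t u ↔ ∃ τ ∈ Q.points (.service i) ω, τ ∈ Ioo t u := by
  constructor
  · rintro ⟨x, hx, hxu⟩
    exact ⟨x.2, hx.1, hxu⟩
  · rintro ⟨τ, hτ, hτu⟩
    have hf : (Q.points (.service i) ω ∩ Ioo t u).Finite :=
      ((Q.poisson (.service i)).locallyFinite ω u).subset
        (inter_subset_inter_right _ (Ioo_subset_Ioc_self.trans (Ioc_subset_Ioc_left ht)))
    obtain ⟨C, ⟨hC, hCu⟩, hmin⟩ := Set.exists_min_image _ id hf ⟨τ, hτ, hτu⟩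
    refine ⟨((Q.stateBefore C ω).servGen, C), ⟨hC, ?_, rfl⟩, hCu⟩
    refine Q.stateBefore_induction ht hCu.1 (fun x => x.serving = some i) hi ?_
    intro c σ x hσ hσC hx
    refine serving_act_of_serving_eq ?_ hx
    rintro rfl
    exact absurd (hmin σ ⟨hσ, hσC.1, hσC.2.trans hCu.2⟩) (not_le.2 hσC.2)

/-- If class `i` is not in service at time `t`, a completion of class `i` in `(t, u)` needs a point
of some other clock as well, since a class-`i` service has to be started first. -/
theorem exists_other_clock_of_completion {i : Fin N} {t u : ℝ} (ht : 0 ≤ t) {ω : Ω}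
    (hi : (Q.state t ω).serving ≠ some i) (h : ω ∈ Q.completionEvent i t u) :
    (∃ τ ∈ Q.points (.service i) ω, τ ∈ Ioo t u) ∧
      ∃ c, c ≠ .service i ∧ ∃ τ ∈ Q.points c ω, τ ∈ Ioo t u := by
  obtain ⟨x, hx, hxu⟩ := h
  refine ⟨⟨x.2, hx.1, hxu⟩, ?_⟩
  by_contra! hno
  refine (Q.stateBefore_induction ht hxu.1 (fun y => y.serving ≠ some i) hi ?_) hx.2.1
  intro c σ y hσ hσx hy
  have hc : c = .service i := by
    by_contra hc
    exact hno c hc σ hσ ⟨hσx.1, hσx.2.trans hxu.2⟩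
  rwa [act_eq_self_of_serving_ne hc hy]

end PriorityQueue

/-! ### Measurability of the dynamics -/

/-- A function that agrees with a measurable one on each piece of a countable measurable partition
is measurable. -/
theorem measurable_of_countable_partition {X Y ι : Type*} {mX : MeasurableSpace X}
    {mY : MeasurableSpace Y} [Countable ι] {p : X → ι} (hp : ∀ v, MeasurableSet (p ⁻¹' {v}))
    {f : X → Y} (h : ∀ v, ∃ g : X → Y, Measurable g ∧ ∀ x, p x = v → f x = g x) :
    Measurable f := by
  intro s hs
  choose g hg hfg using h
  have : f ⁻¹' s = ⋃ v, p ⁻¹' {v} ∩ g v ⁻¹' s := by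
    ext x
    simp only [mem_preimage, mem_iUnion, mem_inter_iff, mem_singleton_iff]
    constructor
    · intro hx
      exact ⟨p x, rfl, by rwa [← hfg _ x rfl]⟩
    · rintro ⟨v, hv, hx⟩
      rwa [hfg v x hv]
  rw [this]
  exact MeasurableSet.iUnion fun v => (hp v).inter (hg v hs)

/-- A pointwise eventual limit of measurable sets is measurable. -/
theorem measurableSet_of_eventually_iff {X : Type*} {mX : MeasurableSpace X} {A : ℕ → Set X}
    {B : Set X} (hA : ∀ n, MeasurableSet (A n)) (h : ∀ x, ∀ᶠ n in atTop, (x ∈ A n ↔ x ∈ B)) :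
    MeasurableSet B := by
  have : B = ⋃ m, ⋂ n ≥ m, A n := by
    ext x
    obtain ⟨m, hm⟩ := eventually_atTop.1 (h x)
    simp only [mem_iUnion, mem_iInter]
    constructor
    · intro hx
      exact ⟨m, fun n hn => (hm n hn).2 hx⟩
    · rintro ⟨k, hk⟩
      exact (hm (max m k) (le_max_left _ _)).1 (hk _ (le_max_right _ _))
  rw [this]
  exact MeasurableSet.iUnion fun m => MeasurableSet.iInter fun n => MeasurableSet.iInter fun _ =>
    hA n

theorem measurable_of_eventually_abs_sub_le {X : Type*} {mX : MeasurableSpace X} {u : ℕ → X → ℝ}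
    {f : X → ℝ} {ε : ℕ → ℝ} (hu : ∀ n, Measurable (u n)) (hε : Tendsto ε atTop (𝓝 0))
    (h : ∀ x, ∀ᶠ n in atTop, |u n x - f x| ≤ ε n) : Measurable f := by
  refine measurable_of_tendsto_metrizable hu ?_
  rw [tendsto_pi_nhds]
  intro x
  rw [tendsto_iff_dist_tendsto_zero]
  exact squeeze_zero' (Eventually.of_forall fun _ => dist_nonneg) (h x) hε

namespace QState

variable {N : ℕ}

/-- The discrete coordinates of a state: the class in service and the set of nonempty buffers. -/
def shape (x : QState N) : Option (Fin N) × (Fin N → Bool) := (x.serving, fun k => x.waiting k)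

/-- Measurability of a random state in terms of its shape and its generation times. -/
theorem measurable_iff {X : Type*} {mX : MeasurableSpace X} {f : X → QState N} :
    Measurable f ↔ (∀ v, MeasurableSet {x | (f x).shape = v}) ∧
      Measurable (fun x => (f x).servGen) ∧ ∀ k, Measurable (fun x => (f x).bufGen k) := by
  have key : Measurable f ↔ Measurable[mX, ⊤] (fun x => (f x).serving) ∧
      Measurable (fun x => (f x).servGen) ∧
      (∀ k, Measurable[mX, ⊤] (fun x => (f x).waiting k)) ∧
      ∀ k, Measurable (fun x => (f x).bufGen k) := by
    simp only [measurable_iff_comap_le, instMeasurableSpace, MeasurableSpace.comap_sup,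
      MeasurableSpace.comap_iSup, MeasurableSpace.comap_comp, sup_le_iff, iSup_le_iff, and_assoc]
    rfl
  rw [key]
  constructor
  · rintro ⟨h1, h2, h3, h4⟩
    refine ⟨fun v => ?_, h2, h4⟩
    have : {x | (f x).shape = v} = {x | (f x).serving = v.1} ∩
        ⋂ k, {x | (f x).waiting k = v.2 k} := by
      ext x
      simp [shape, Prod.ext_iff, funext_iff]
    rw [this]
    exact (h1 (t := {v.1}) trivial).inter
      (MeasurableSet.iInter fun k => h3 k (t := {v.2 k}) trivial)
  · rintro ⟨h1, h2, h3⟩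
    have hsh : ∀ s : Set (Option (Fin N) × (Fin N → Bool)),
        MeasurableSet {x | (f x).shape ∈ s} := by
      intro s
      have : {x | (f x).shape ∈ s} = ⋃ v ∈ s, {x | (f x).shape = v} := by
        ext x; simp
      rw [this]
      exact MeasurableSet.biUnion (to_countable s) fun v _ => h1 v
    exact ⟨fun s _ => hsh {v | v.1 ∈ s}, h2, fun k s _ => hsh {v | v.2 k ∈ s}, h3⟩

theorem measurableSet_shape (v) : MeasurableSet {x : QState N | x.shape = v} :=
  (measurable_iff.1 measurable_id).1 v

theorem measurable_servGen : Measurable (servGen : QState N → ℝ) :=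
  (measurable_iff.1 measurable_id).2.1

theorem measurable_bufGen (k : Fin N) : Measurable (bufGen k : QState N → ℝ) :=
  (measurable_iff.1 measurable_id).2.2 k

theorem measurableSet_serving (v) : MeasurableSet {x : QState N | x.serving = v} := by
  have : {x : QState N | x.serving = v} = ⋃ w, {x : QState N | x.shape = (v, w)} := by
    ext x; simp [shape]
  rw [this]
  exact MeasurableSet.iUnion fun w => measurableSet_shape _

/-- The smallest element of a set of classes, if there is one. -/
def firstClass (s : Finset (Fin N)) : Option (Fin N) :=
  if h : s.Nonempty then some (s.min' h) else none

/-- The next packet to be served depends on the buffers only through the set of nonempty ones. -/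
theorem startNext_eq (buf : Fin N → Option ℝ) :
    startNext buf =
      match firstClass (Finset.univ.filter fun k => (buf k).isSome = true) with
      | none => idle
      | some k => busy k ((buf k).getD 0) (Function.update buf k none) := by
  have : (Finset.univ.filter fun k => (buf k).isSome = true) =
      Finset.univ.filter fun k => buf k ≠ none := by
    ext k; simp [Option.isSome_iff_ne_none]
  rw [this]
  unfold startNext firstClass
  by_cases h : (Finset.univ.filter fun k => buf k ≠ none).Nonempty
  · simp only [dif_pos h]
  · simp only [dif_neg h]

/-- The real numbers that the dynamics can copy into a generation time: a generation time present in
the state, the current time `τ`, or the default value `0`. -/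
def IsSource (g : ℝ → QState N → ℝ) : Prop :=
  g = (fun _ x => x.servGen) ∨ g = (fun τ _ => τ) ∨ g = (fun _ _ => 0) ∨
    ∃ k, g = fun _ x => x.bufGen k

theorem IsSource.measurable {g : ℝ → QState N → ℝ} (hg : IsSource g) (τ : ℝ) :
    Measurable (g τ) := by
  obtain rfl | rfl | rfl | ⟨k, rfl⟩ := hg
  · exact measurable_servGen
  · exact measurable_const
  · exact measurable_const
  · exact measurable_bufGen k

theorem shape_idle_eq {x : QState N} (h : x.shape = shape idle) : x = idle := by
  cases x with
  | idle => rfl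
  | busy j r buf => simp [shape, serving] at h

theorem shape_busy_eq {x : QState N} {j r buf} (h : x.shape = shape (busy j r buf)) :
    ∃ r' buf', x = busy j r' buf' ∧ ∀ k, (buf' k).isSome = (buf k).isSome := by
  cases x with
  | idle => simp [shape, serving] at h
  | busy j' r' buf' =>
    simp only [shape, serving, waiting, Prod.mk.injEq, Option.some.injEq, funext_iff] at h
    exact ⟨r', buf', by rw [h.1], h.2⟩

/-- The discrete part of the dynamics is autonomous: it does not depend on the generation times. -/
theorem shape_act {x y : QState N} (h : x.shape = y.shape) (c : Clock N) (τ τ' : ℝ) :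
    (c.act τ x).shape = (c.act τ' y).shape := by
  cases y with
  | idle =>
    rw [shape_idle_eq h]
    cases c with
    | arrival k => rfl
    | service k => rfl
  | busy j r buf =>
    obtain ⟨r', buf', rfl, hb⟩ := shape_busy_eq h
    cases c with
    | arrival k =>
      simp only [Clock.act, arrive, shape, serving, waiting, Function.update_apply, Prod.mk.injEq,
        true_and]
      funext k'
      split
      · rfl
      · exact hb k'
    | service k =>
      simp only [Clock.act, complete]
      split
      · simp only [startNext_eq, hb]
        cases firstClass (Finset.univ.filter fun k => (buf k).isSome = true) with
        | none => rfl
        | some k' =>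
          simp only [shape, serving, waiting, Function.update_apply, Prod.mk.injEq, true_and]
          funext l
          split
          · rfl
          · exact hb l
      · simpa [shape, serving, waiting] using funext hb

/-- For states of a given shape, the generation time in service after an event is a copy of one
fixed source. -/
theorem exists_source_servGen (y : QState N) (c : Clock N) :
    ∃ g, IsSource g ∧ ∀ (x : QState N) (τ : ℝ), x.shape = y.shape →
      (c.act τ x).servGen = g τ x := by
  cases y with
  | idle =>
    cases c with
    | arrival k =>
      refine ⟨_, Or.inr (Or.inl rfl), fun x τ h => ?_⟩
      rw [shape_idle_eq h]; rfl
    | service k =>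
      refine ⟨_, Or.inr (Or.inr (Or.inl rfl)), fun x τ h => ?_⟩
      rw [shape_idle_eq h]; rfl
  | busy j r buf =>
    cases c with
    | arrival k =>
      refine ⟨_, Or.inl rfl, fun x τ h => ?_⟩
      obtain ⟨r', buf', rfl, hb⟩ := shape_busy_eq h
      rfl
    | service k =>
      by_cases hj : j = k
      · cases hf : firstClass (Finset.univ.filter fun k => (buf k).isSome = true) with
        | none =>
          refine ⟨_, Or.inr (Or.inr (Or.inl rfl)), fun x τ h => ?_⟩
          obtain ⟨r', buf', rfl, hb⟩ := shape_busy_eq h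
          simp only [Clock.act, complete, if_pos hj, startNext_eq, hb, hf, servGen]
        | some l =>
          refine ⟨_, Or.inr (Or.inr (Or.inr ⟨l, rfl⟩)), fun x τ h => ?_⟩
          obtain ⟨r', buf', rfl, hb⟩ := shape_busy_eq h
          simp only [Clock.act, complete, if_pos hj, startNext_eq, hb, hf, servGen, bufGen]
      · refine ⟨_, Or.inl rfl, fun x τ h => ?_⟩
        obtain ⟨r', buf', rfl, hb⟩ := shape_busy_eq h
        simp only [Clock.act, complete, if_neg hj]

/-- For states of a given shape, the generation time in a buffer after an event is a copy of one
fixed source. -/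
theorem exists_source_bufGen (y : QState N) (c : Clock N) (l : Fin N) :
    ∃ g, IsSource g ∧ ∀ (x : QState N) (τ : ℝ), x.shape = y.shape →
      (c.act τ x).bufGen l = g τ x := by
  cases y with
  | idle =>
    refine ⟨_, Or.inr (Or.inr (Or.inl rfl)), fun x τ h => ?_⟩
    rw [shape_idle_eq h]
    cases c <;> rfl
  | busy j r buf =>
    cases c with
    | arrival k =>
      by_cases hl : l = k
      · refine ⟨_, Or.inr (Or.inl rfl), fun x τ h => ?_⟩
        obtain ⟨r', buf', rfl, hb⟩ := shape_busy_eq h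
        simp [Clock.act, arrive, bufGen, hl]
      · refine ⟨_, Or.inr (Or.inr (Or.inr ⟨l, rfl⟩)), fun x τ h => ?_⟩
        obtain ⟨r', buf', rfl, hb⟩ := shape_busy_eq h
        simp [Clock.act, arrive, bufGen, hl]
    | service k =>
      by_cases hj : j = k
      · cases hf : firstClass (Finset.univ.filter fun k => (buf k).isSome = true) with
        | none =>
          refine ⟨_, Or.inr (Or.inr (Or.inl rfl)), fun x τ h => ?_⟩
          obtain ⟨r', buf', rfl, hb⟩ := shape_busy_eq h
          simp only [Clock.act, complete, if_pos hj, startNext_eq, hb, hf, bufGen]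
        | some l' =>
          by_cases hl : l = l'
          · refine ⟨_, Or.inr (Or.inr (Or.inl rfl)), fun x τ h => ?_⟩
            obtain ⟨r', buf', rfl, hb⟩ := shape_busy_eq h
            simp [Clock.act, complete, if_pos hj, startNext_eq, hb, hf, bufGen, hl]
          · refine ⟨_, Or.inr (Or.inr (Or.inr ⟨l, rfl⟩)), fun x τ h => ?_⟩
            obtain ⟨r', buf', rfl, hb⟩ := shape_busy_eq h
            simp [Clock.act, complete, if_pos hj, startNext_eq, hb, hf, bufGen, hl]
      · refine ⟨_, Or.inr (Or.inr (Or.inr ⟨l, rfl⟩)), fun x τ h => ?_⟩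
        obtain ⟨r', buf', rfl, hb⟩ := shape_busy_eq h
        simp only [Clock.act, complete, if_neg hj]

theorem measurable_act (c : Clock N) (τ : ℝ) : Measurable (c.act τ) := by
  rw [measurable_iff]
  refine ⟨fun v => ?_, ?_, fun k => ?_⟩
  · have : {x : QState N | (c.act τ x).shape = v} =
        ⋃ w ∈ {w | ∃ y : QState N, y.shape = w ∧ (c.act τ y).shape = v},
          {x : QState N | x.shape = w} := by
      ext x
      simp only [mem_ofPred_eq, mem_iUnion, exists_prop]
      constructor
      · intro h
        exact ⟨_, ⟨x, rfl, h⟩, rfl⟩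
      · rintro ⟨w, ⟨y, rfl, hy⟩, hx⟩
        rw [shape_act hx c τ τ, hy]
    rw [this]
    exact MeasurableSet.biUnion (to_countable _) fun w _ => measurableSet_shape w
  · refine measurable_of_countable_partition (p := shape) measurableSet_shape fun v => ?_
    by_cases hv : ∃ y : QState N, y.shape = v
    · obtain ⟨y, rfl⟩ := hv
      obtain ⟨g, hg, h⟩ := exists_source_servGen y c
      exact ⟨g τ, hg.measurable τ, fun x hx => h x τ hx⟩
    · exact ⟨fun _ => 0, measurable_const, fun x hx => absurd ⟨x, hx⟩ hv⟩
  · refine measurable_of_countable_partition (p := shape) measurableSet_shape fun v => ?_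
    by_cases hv : ∃ y : QState N, y.shape = v
    · obtain ⟨y, rfl⟩ := hv
      obtain ⟨g, hg, h⟩ := exists_source_bufGen y c k
      exact ⟨g τ, hg.measurable τ, fun x hx => h x τ hx⟩
    · exact ⟨fun _ => 0, measurable_const, fun x hx => absurd ⟨x, hx⟩ hv⟩

/-- Two states that agree up to an error of at most `ε` in the generation times. -/
def Near (ε : ℝ) (x y : QState N) : Prop :=
  x.shape = y.shape ∧ |x.servGen - y.servGen| ≤ ε ∧ ∀ k, |x.bufGen k - y.bufGen k| ≤ ε

theorem IsSource.near {g : ℝ → QState N → ℝ} (hg : IsSource g) {ε τ τ' : ℝ} (hτ : |τ - τ'| ≤ ε)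
    {x y : QState N} (h : Near ε x y) : |g τ x - g τ' y| ≤ ε := by
  obtain rfl | rfl | rfl | ⟨k, rfl⟩ := hg
  · exact h.2.1
  · exact hτ
  · simpa using (abs_nonneg _).trans hτ
  · exact h.2.2 k

/-- Events do not amplify errors in the generation times, as these are only copied. -/
theorem Near.act {ε τ τ' : ℝ} (hτ : |τ - τ'| ≤ ε) {x y : QState N} (h : Near ε x y)
    (c : Clock N) : Near ε (c.act τ x) (c.act τ' y) := by
  refine ⟨shape_act h.1 c τ τ', ?_, fun k => ?_⟩
  · obtain ⟨g, hg, h'⟩ := exists_source_servGen y c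
    rw [h' x τ h.1, h' y τ' rfl]
    exact hg.near hτ h
  · obtain ⟨g, hg, h'⟩ := exists_source_bufGen y c k
    rw [h' x τ h.1, h' y τ' rfl]
    exact hg.near hτ h

end QState

/-! ### Approximation of the dynamics on a time grid -/

section Grid

variable {N : ℕ}

open Classical in
/-- Effect of a point of the clock `c` at time `τ` on the state and on the generation time of the
freshest delivered update of class `i`. -/
noncomputable def Clock.actFresh (i : Fin N) (τ : ℝ) (c : Clock N) (x : QState N × ℝ) :
    QState N × ℝ :=
  (c.act τ x.1, if c = .service i ∧ x.1.serving = some i then max x.2 x.1.servGen else x.2)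

theorem Clock.measurable_actFresh (i : Fin N) (τ : ℝ) (c : Clock N) :
    Measurable (Clock.actFresh i τ c) := by
  refine ((QState.measurable_act c τ).comp measurable_fst).prodMk ?_
  refine Measurable.ite ?_ (measurable_snd.max (QState.measurable_servGen.comp measurable_fst))
    measurable_snd
  by_cases hc : c = .service i
  · simpa [hc] using measurable_fst (QState.measurableSet_serving (some i))
  · simp [hc]

open Classical in
/-- One grid cell `(a, b]`: a clock with a point in the cell, if there is one, acts at the end of
the cell. Here `n c t` is the number of points of the clock `c` up to time `t`. -/
noncomputable def gridStep (i : Fin N) (a b : ℝ≥0) (n : Clock N → ℝ≥0 → ℕ) (x : QState N × ℝ) :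
    QState N × ℝ :=
  if h : ∃ c, n c a < n c b then h.choose.actFresh i b x else x

/-- Processing the first `k` cells of the grid `g`. -/
noncomputable def gridRun (i : Fin N) (g : ℕ → ℝ≥0) (n : Clock N → ℝ≥0 → ℕ) (x : QState N × ℝ) :
    ℕ → QState N × ℝ
  | 0 => x
  | k + 1 => gridStep i (g k) (g (k + 1)) n (gridRun i g n x k)

theorem measurable_gridStep {Ω : Type*} {mΩ : MeasurableSpace Ω} (i : Fin N) (a b : ℝ≥0)
    {n : Ω → Clock N → ℝ≥0 → ℕ} {x : Ω → QState N × ℝ} (hx : Measurable x)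
    (ha : ∀ c, Measurable fun ω => n ω c a) (hb : ∀ c, Measurable fun ω => n ω c b) :
    Measurable fun ω => gridStep i a b (n ω) (x ω) := by
  classical
  refine measurable_of_countable_partition (ι := Set (Clock N))
    (p := fun ω => {c | n ω c a < n ω c b}) (fun v => ?_) fun v => ?_
  · have : (fun ω => {c | n ω c a < n ω c b}) ⁻¹' {v} =
        ⋂ c, {ω | (n ω c a < n ω c b) ↔ c ∈ v} := by
      ext ω
      simp [Set.ext_iff]
    rw [this]
    refine MeasurableSet.iInter fun c => ?_
    have hlt := measurableSet_lt (ha c) (hb c)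
    by_cases hc : c ∈ v
    · simpa [hc] using hlt
    · simpa [hc] using measurableSet_le (hb c) (ha c)
  · by_cases h : ∃ c, c ∈ v
    · refine ⟨fun ω => h.choose.actFresh i b (x ω), (Clock.measurable_actFresh _ _ _).comp hx,
        fun ω hω => ?_⟩
      subst hω
      exact dif_pos h
    · refine ⟨x, hx, fun ω hω => ?_⟩
      subst hω
      exact dif_neg h

theorem measurable_gridRun {Ω : Type*} {mΩ : MeasurableSpace Ω} (i : Fin N) (g : ℕ → ℝ≥0)
    {n : Ω → Clock N → ℝ≥0 → ℕ} {x : Ω → QState N × ℝ} (hx : Measurable x) {K : ℕ}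
    (hn : ∀ c, ∀ k ≤ K, Measurable fun ω => n ω c (g k)) :
    ∀ k ≤ K, Measurable fun ω => gridRun i g (n ω) (x ω) k
  | 0, _ => hx
  | k + 1, hk => measurable_gridStep i _ _
      (measurable_gridRun i g hx hn k (Nat.le_of_succ_le hk))
      (fun c => hn c k (Nat.le_of_succ_le hk)) fun c => hn c (k + 1) hk

end Grid

theorem IsPoissonProcess.count_lt_count_iff {Ω : Type*} [MeasurableSpace Ω] {P : Measure Ω}
    {pts : Ω → Set ℝ} {r : ℝ → ℝ} (h : IsPoissonProcess P pts r) {a b : ℝ≥0} (hab : a ≤ b)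
    (ω : Ω) : count pts a ω < count pts b ω ↔ ∃ τ ∈ pts ω, τ ∈ Ioc (a : ℝ) b := by
  have hsub : pts ω ∩ Ioc 0 (a : ℝ) ⊆ pts ω ∩ Ioc 0 (b : ℝ) :=
    inter_subset_inter_right _ (Ioc_subset_Ioc_right (by exact_mod_cast hab))
  constructor
  · intro hlt
    by_contra! hno
    refine hlt.ne (congrArg Set.ncard (hsub.antisymm ?_))
    rintro τ ⟨h1, h2, h3⟩
    exact ⟨h1, h2, not_lt.1 fun h' => hno τ h1 ⟨h', h3⟩⟩
  · rintro ⟨τ, hτ, h1, h2⟩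
    refine Set.ncard_lt_ncard (Set.ssubset_iff_of_subset hsub |>.2 ⟨τ, ⟨hτ, ?_, h2⟩, ?_⟩)
      (h.locallyFinite ω b)
    · exact a.2.trans_lt h1
    · exact fun h' => not_le.2 h1 h'.2.2

theorem IsPoissonProcess.count_mono {Ω : Type*} [MeasurableSpace Ω] {P : Measure Ω}
    {pts : Ω → Set ℝ} {r : ℝ → ℝ} (h : IsPoissonProcess P pts r) {a b : ℝ≥0} (hab : a ≤ b)
    (ω : Ω) : count pts a ω ≤ count pts b ω :=
  Set.ncard_le_ncard (inter_subset_inter_right _ (Ioc_subset_Ioc_right (by exact_mod_cast hab)))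
    (h.locallyFinite ω b)

theorem count_zero {Ω : Type*} (pts : Ω → Set ℝ) (ω : Ω) : count pts 0 ω = 0 := by
  simp [count]

namespace PriorityQueue

variable {Ω : Type*} [MeasurableSpace Ω] {P : Measure Ω} {N : ℕ} {R : Rates N}
  (Q : PriorityQueue P R)

/-- A grid run stays close to the real evolution as long as no grid cell contains two events. -/
theorem gridRun_near (i : Fin N) {ω : Ω} {g : ℕ → ℝ≥0} (hg : Monotone g) (hg0 : g 0 = 0) {ε : ℝ}
    (hε : 0 ≤ ε) {K : ℕ} (hmesh : ∀ k < K, (g (k + 1) : ℝ) - g k ≤ ε)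
    (hsep : ∀ k < K, ∀ c c' τ τ', τ ∈ Q.points c ω → τ' ∈ Q.points c' ω →
      τ ∈ Ioc (g k : ℝ) (g (k + 1)) → τ' ∈ Ioc (g k : ℝ) (g (k + 1)) → τ = τ') :
    ∀ k ≤ K,
      (gridRun i g (fun c t => count (Q.points c) t ω) (Q.init ω, Q.lastGen ω i) k).1.Near ε
        (Q.state (g k) ω) ∧
      |(gridRun i g (fun c t => count (Q.points c) t ω) (Q.init ω, Q.lastGen ω i) k).2 -
        Q.fresh i (g k) ω| ≤ ε := by
  classical
  intro k
  induction k with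
  | zero =>
    intro _
    simp only [gridRun, hg0, NNReal.coe_zero, state_zero, fresh_zero, sub_self, abs_zero]
    exact ⟨⟨rfl, by simpa, fun k => by simpa⟩, hε⟩
  | succ k ih =>
    intro hk
    obtain ⟨ih1, ih2⟩ := ih (Nat.le_of_succ_le hk)
    set y := gridRun i g (fun c t => count (Q.points c) t ω) (Q.init ω, Q.lastGen ω i) k with hy
    have hle : g k ≤ g (k + 1) := hg k.le_succ
    have hle' : (g k : ℝ) ≤ g (k + 1) := by exact_mod_cast hle
    simp only [gridRun, gridStep, ← hy]
    split_ifs with h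
    · have hc := h.choose_spec
      set c := h.choose
      rw [(Q.poisson c).count_lt_count_iff hle] at hc
      obtain ⟨τ, hτ, hτk⟩ := hc
      have huniq : ∀ c' σ, σ ∈ Q.points c' ω → σ ∈ Ioc (g k : ℝ) (g (k + 1)) → σ = τ :=
        fun c' σ hσ hσk => hsep k hk c' c σ τ hσ hτ hσk hτk
      have hbefore : Q.stateBefore τ ω = Q.state (g k) ω := by
        refine Q.stateBefore_eq_of_forall_notMem (g k).2 hτk.1 fun c' σ hσ hσk => ?_
        exact hσk.2.ne (huniq c' σ hσ ⟨hσk.1, hσk.2.le.trans hτk.2⟩)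
      have hstate : Q.state (g (k + 1)) ω = c.act τ (Q.state (g k) ω) := by
        rw [← hbefore, ← Q.state_eq_act_stateBefore hτ]
        refine Q.state_eq_of_forall_notMem ((g k).2.trans hτk.1.le) hτk.2 fun c' σ hσ hσk => ?_
        exact hσk.1.ne' (huniq c' σ hσ ⟨hτk.1.trans hσk.1, hσk.2⟩)
      have hτb : |(g (k + 1) : ℝ) - τ| ≤ ε := by
        rw [abs_of_nonneg (sub_nonneg.2 hτk.2)]
        exact (sub_le_sub_left hτk.1.le _).trans (hmesh k hk)
      refine ⟨?_, ?_⟩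
      · rw [hstate]
        exact ih1.act hτb c
      · have hserv : y.1.serving = (Q.state (g k) ω).serving := (Prod.ext_iff.1 ih1.1).1
        simp only [Clock.actFresh]
        split_ifs with hci
        · rw [Q.fresh_eq_max (g k).2 hτk (hci.1 ▸ hτ) (by rw [hbefore, ← hserv, hci.2])
            fun σ hσ hσk => huniq _ σ hσ hσk, hbefore]
          exact (abs_max_sub_max_le_max _ _ _ _).trans (max_le ih2 ih1.2.1)
        · rw [Q.fresh_eq_of_forall_notMem (g k).2 hle']
          · exact ih2
          · intro x hx hxk
            have hxτ := huniq _ x.2 hx.1 hxk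
            refine hci ⟨?_, ?_⟩
            · by_contra hne
              exact Set.disjoint_left.1 (Q.points_disjoint ω _ _ hne) hτ (hxτ ▸ hx.1)
            · rw [hserv, ← hbefore, ← hxτ, hx.2.1]
    · have hno : ∀ c, ∀ τ ∈ Q.points c ω, τ ∉ Ioc (g k : ℝ) (g (k + 1)) := fun c τ hτ hτk =>
        h ⟨c, ((Q.poisson c).count_lt_count_iff hle ω).2 ⟨τ, hτ, hτk⟩⟩
      rw [Q.state_eq_of_forall_notMem (g k).2 hle' hno,
        Q.fresh_eq_of_forall_notMem (g k).2 hle' fun x hx => hno _ _ hx.1]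
      exact ⟨ih1, ih2⟩

/-- The uniform grid of mesh `t / (n + 1)`. -/
noncomputable def grid (t : ℝ≥0) (n k : ℕ) : ℝ≥0 := t * (k / (n + 1))

theorem grid_mono (t : ℝ≥0) (n : ℕ) : Monotone (grid t n) := by
  intro a b hab
  unfold grid
  gcongr

theorem grid_last (t : ℝ≥0) (n : ℕ) : grid t n (n + 1) = t := by
  simp [grid]

theorem grid_mesh (t : ℝ≥0) (n k : ℕ) : (grid t n (k + 1) : ℝ) - grid t n k = t / (n + 1) := by
  simp only [grid]
  push_cast
  field_simp
  ring

/-- A sufficiently fine grid separates the finitely many events of a sample, so its run is accurate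
up to the mesh. -/
theorem eventually_gridRun_near (i : Fin N) (t : ℝ≥0) (ω : Ω) :
    ∀ᶠ n : ℕ in atTop,
      (gridRun i (grid t n) (fun c t => count (Q.points c) t ω) (Q.init ω, Q.lastGen ω i)
        (n + 1)).1.Near (t / (n + 1)) (Q.state t ω) ∧
      |(gridRun i (grid t n) (fun c t => count (Q.points c) t ω) (Q.init ω, Q.lastGen ω i)
        (n + 1)).2 - Q.fresh i t ω| ≤ t / (n + 1) := by
  have hf := Q.finite_eventTimes ω (Subset.refl (Ioc 0 (t : ℝ)))
  have hlim : Tendsto (fun n : ℕ => (t : ℝ) / (n + 1)) atTop (𝓝 0) := by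
    simpa [Function.comp_def] using
      (tendsto_const_div_atTop_nhds_zero_nat (t : ℝ)).comp (tendsto_add_atTop_nat 1)
  have hsep : ∀ᶠ n : ℕ in atTop, ∀ σ ∈ Q.eventTimes ω (Ioc 0 (t : ℝ)),
      ∀ τ ∈ Q.eventTimes ω (Ioc 0 (t : ℝ)), σ ≠ τ → (t : ℝ) / (n + 1) < |σ - τ| := by
    rw [hf.eventually_all]
    intro σ _
    rw [hf.eventually_all]
    intro τ _
    by_cases h : σ = τ
    · simp [h]
    · filter_upwards [hlim.eventually_lt_const (abs_pos.2 (sub_ne_zero.2 h))] with n hn _ using hn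
  filter_upwards [hsep] with n hn
  have := Q.gridRun_near i (ω := ω) (grid_mono t n) (by simp [grid]) (ε := t / (n + 1))
    (by positivity) (K := n + 1) (fun k _ => (grid_mesh t n k).le) ?_ (n + 1) le_rfl
  · rwa [grid_last] at this
  · intro k hk c c' σ τ hσ hτ hσk hτk
    have hkt : (grid t n (k + 1) : ℝ) ≤ t := by
      have := grid_mono t n (Nat.succ_le_of_lt hk)
      rw [grid_last] at this
      exact_mod_cast this
    have hmem : ∀ {c : Clock N} {σ : ℝ}, σ ∈ Q.points c ω →
        σ ∈ Ioc (grid t n k : ℝ) (grid t n (k + 1)) → σ ∈ Q.eventTimes ω (Ioc 0 (t : ℝ)) :=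
      fun {c σ} hσ hσk =>
        ⟨⟨(grid t n k).2.trans_lt hσk.1, hσk.2.trans hkt⟩, c, hσ⟩
    by_contra hne
    refine absurd (hn σ (hmem hσ hσk) τ (hmem hτ hτk) hne) (not_lt.2 ?_)
    rw [← grid_mesh t n k, abs_le]
    constructor <;> linarith [hσk.1, hσk.2, hτk.1, hτk.2]

/-- The state at time `t` and the freshest delivered update are measurable functions of the
initial situation and of the clocks up to time `t`. -/
theorem measurable_state_fresh {Ω : Type*} {m : MeasurableSpace Ω} [MeasurableSpace Ω]
    {P : Measure Ω} (Q : PriorityQueue P R) (i : Fin N) (t : ℝ≥0)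
    (hinit : Measurable[m] Q.init) (hlast : Measurable[m] fun ω => Q.lastGen ω i)
    (hcount : ∀ c, ∀ s ≤ t, Measurable[m] (count (Q.points c) s)) :
    Measurable[m] (Q.state t) ∧ Measurable[m] (Q.fresh i t) := by
  have hmeas : ∀ n : ℕ, Measurable[m] fun ω => gridRun i (grid t n)
      (fun c t => count (Q.points c) t ω) (Q.init ω, Q.lastGen ω i) (n + 1) := by
    intro n
    refine measurable_gridRun i (grid t n) (hinit.prodMk hlast) (K := n + 1) ?_ (n + 1) le_rfl
    intro c k hk
    refine hcount c _ ?_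
    have := grid_mono t n hk
    rwa [grid_last] at this
  have hlim : Tendsto (fun n : ℕ => (t : ℝ) / (n + 1)) atTop (𝓝 0) := by
    simpa [Function.comp_def] using
      (tendsto_const_div_atTop_nhds_zero_nat (t : ℝ)).comp (tendsto_add_atTop_nat 1)
  have key := Q.eventually_gridRun_near i t
  have hreal : ∀ {F : QState N × ℝ → ℝ} {f : Ω → ℝ}, Measurable F →
      (∀ ω, ∀ᶠ n : ℕ in atTop, |F (gridRun i (grid t n)
        (fun c t => count (Q.points c) t ω) (Q.init ω, Q.lastGen ω i) (n + 1)) - f ω|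
          ≤ t / (n + 1)) → Measurable[m] f := by
    intro F f hF h
    exact measurable_of_eventually_abs_sub_le (fun n => hF.comp (hmeas n)) hlim h
  refine ⟨QState.measurable_iff.2 ⟨fun v => ?_, ?_, fun k => ?_⟩, ?_⟩
  · refine measurableSet_of_eventually_iff
      (fun n => (hmeas n) (measurable_fst (QState.measurableSet_shape v))) fun ω => ?_
    filter_upwards [key ω] with n hn
    simp only [mem_preimage, mem_ofPred_eq]
    rw [hn.1.1]
  · exact hreal (QState.measurable_servGen.comp measurable_fst) fun ω =>
      (key ω).mono fun n hn => hn.1.2.1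
  · exact hreal ((QState.measurable_bufGen k).comp measurable_fst) fun ω =>
      (key ω).mono fun n hn => hn.1.2.2 k
  · exact hreal measurable_snd fun ω => (key ω).mono fun n hn => hn.2

end PriorityQueue

/-! ### Independence of the past and the future increments -/

/-- If `X` is independent of `(Y, Z)` and `Y` of `Z`, then `(X, Y)` is independent of `Z`. -/
theorem indepFun_prodMk_left_of_indepFun {Ω α β γ : Type*} [MeasurableSpace Ω]
    [MeasurableSpace α] [MeasurableSpace β] [MeasurableSpace γ] {P : Measure Ω}
    [IsProbabilityMeasure P] {X : Ω → α} {Y : Ω → β} {Z : Ω → γ} (hX : Measurable X)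
    (hY : Measurable Y) (hZ : Measurable Z) (h1 : IndepFun X (fun ω => (Y ω, Z ω)) P)
    (h2 : IndepFun Y Z P) : IndepFun (fun ω => (X ω, Y ω)) Z P := by
  have hXY : IndepFun X Y P := h1.comp measurable_id measurable_fst
  rw [indepFun_iff_map_prod_eq_prod_map_map hX.aemeasurable (hY.prodMk hZ).aemeasurable,
    (indepFun_iff_map_prod_eq_prod_map_map hY.aemeasurable hZ.aemeasurable).1 h2] at h1
  rw [indepFun_iff_map_prod_eq_prod_map_map (hX.prodMk hY).aemeasurable hZ.aemeasurable,
    (indepFun_iff_map_prod_eq_prod_map_map hX.aemeasurable hY.aemeasurable).1 hXY]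
  have hm := Measure.isProbabilityMeasure_map (μ := P) hX.aemeasurable
  have hm' := Measure.isProbabilityMeasure_map (μ := P) hY.aemeasurable
  have hm'' := Measure.isProbabilityMeasure_map (μ := P) hZ.aemeasurable
  have h3 := (measurePreserving_prodAssoc (P.map X) (P.map Y) (P.map Z)).symm
  rw [← h3.map_eq, ← h1, Measure.map_map h3.measurable (hX.prodMk (hY.prodMk hZ))]
  rfl

/-- For a family of two members pairwise and mutual independence agree. -/
theorem iIndepFun_bool {Ω α : Type*} [MeasurableSpace Ω] [MeasurableSpace α] {P : Measure Ω}
    [IsProbabilityMeasure P] {X : Bool → Ω → α} (h : IndepFun (X false) (X true) P) :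
    iIndepFun X P := by
  rw [iIndepFun_iff]
  intro s
  have hs : s = ∅ ∨ s = {true} ∨ s = {false} ∨ s = {false, true} := by
    revert s; decide
  intro f hf
  obtain rfl | rfl | rfl | rfl := hs
  · simp
  · simp
  · simp
  · simp only [Finset.mem_insert, Finset.mem_singleton, iInter_iInter_eq_or_left,
      iInter_iInter_eq_left]
    rw [Finset.prod_pair (by decide)]
    exact (IndepFun_iff _ _ _).1 h _ _ (hf false (by simp)) (hf true (by simp))

/-- An increasing process with independent increments that starts at `0`: the path up to time `t` is
independent of the increment over `(t, u]`. -/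
theorem indepFun_path_increment {Ω : Type*} [MeasurableSpace Ω] {P : Measure Ω}
    [IsProbabilityMeasure P] {X : ℝ≥0 → Ω → ℕ} (hX : HasIndepIncrements X P)
    (hmeas : ∀ t, Measurable (X t)) (hmono : ∀ ω, Monotone fun t => X t ω) (h0 : ∀ ω, X 0 ω = 0)
    {t u : ℝ≥0} (htu : t ≤ u) :
    IndepFun (fun ω s => X (min s t) ω) (fun ω => X u ω - X t ω) P := by
  refine IndepFun.process_indepFun (X := fun s ω => X (min s t) ω) (fun s => hmeas _)
    ((hmeas u).sub (hmeas t)) fun I => ?_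
  classical
  set S : Finset ℝ≥0 := insert 0 (insert t (I.image fun s => min s t)) with hS
  have hSt : ∀ s ∈ S, s ≤ t := by
    intro s hs
    simp only [hS, Finset.mem_insert, Finset.mem_image] at hs
    obtain rfl | rfl | ⟨a, -, rfl⟩ := hs
    · exact zero_le
    · exact le_rfl
    · exact min_le_right _ _
  obtain ⟨M, hM⟩ : ∃ M, S.card = M + 1 :=
    Nat.exists_eq_succ_of_ne_zero (Finset.card_ne_zero_of_mem (Finset.mem_insert_self 0 _))
  -- the grid consists of the elements of `S` in increasing order, followed by `u`
  set τ : ℕ → ℝ≥0 := fun k => if h : k < M + 1 then S.orderEmbOfFin hM ⟨k, h⟩ else u with hτ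
  have hτle : ∀ k, k < M + 1 → τ k ≤ t := by
    intro k hk
    simp only [hτ, dif_pos hk]
    exact hSt _ (S.orderEmbOfFin_mem hM _)
  have hτmono : Monotone τ := by
    intro a b hab
    by_cases hb : b < M + 1
    · have ha : a < M + 1 := hab.trans_lt hb
      simp only [hτ, dif_pos ha, dif_pos hb]
      exact (S.orderEmbOfFin hM).monotone hab
    · have : τ b = u := by simp only [hτ, dif_neg hb]
      rw [this]
      by_cases ha : a < M + 1
      · exact (hτle a ha).trans htu
      · simp only [hτ, dif_neg ha, le_refl]
  have hex : ∀ s ∈ S, ∃ k ≤ M, τ k = s := by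
    intro s hs
    have : s ∈ Set.range (S.orderEmbOfFin hM) := by
      rw [Finset.range_orderEmbOfFin]; exact hs
    obtain ⟨k, hk⟩ := this
    exact ⟨k, Nat.lt_succ_iff.1 k.2, by simp only [hτ, dif_pos k.2, hk]⟩
  have hτ0 : τ 0 = 0 := by
    obtain ⟨k, -, hk⟩ := hex 0 (by simp [hS])
    exact le_antisymm (hk ▸ hτmono (Nat.zero_le k)) zero_le
  have hτM : τ M = t := by
    obtain ⟨k, hkM, hk⟩ := hex t (by simp [hS])
    exact le_antisymm (hτle M (Nat.lt_succ_self M)) (hk ▸ hτmono hkM)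
  have hτu : τ (M + 1) = u := by simp [hτ]
  have hsum : ∀ k ω, X (τ k) ω = ∑ j ∈ Finset.range k, (X (τ (j + 1)) ω - X (τ j) ω) := by
    intro k ω
    rw [Finset.sum_range_tsub (f := fun k => X (τ k) ω) ((hmono ω).comp hτmono), hτ0, h0,
      Nat.sub_zero]
  choose! idx hidx using hex
  have hI : ∀ s : I, min s.1 t ∈ S := fun s => by
    simp only [hS, Finset.mem_insert, Finset.mem_image]
    exact Or.inr (Or.inr ⟨s.1, s.2, rfl⟩)
  have hind := (hX.nat hτmono).indepFun_finset (Finset.range M) {M} (by simp)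
    fun j => (hmeas _).sub (hmeas _)
  have := hind.comp (φ := fun d (s : I) => ∑ j : Finset.range M,
      if j.1 < idx (min s.1 t) then d j else 0) (ψ := fun d => d ⟨M, by simp⟩)
    (measurable_of_countable _) (measurable_of_countable _)
  convert! this using 1
  · funext ω s
    simp only [Function.comp]
    obtain ⟨hk, hks⟩ := hidx _ (hI s)
    rw [Finset.sum_coe_sort (Finset.range M) (fun j =>
      if j < idx (min s.1 t) then X (τ (j + 1)) ω - X (τ j) ω else 0), ← Finset.sum_filter]
    conv_lhs => rw [← hks, hsum]
    refine Finset.sum_congr ?_ fun _ _ => rfl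
    ext j
    simp only [Finset.mem_range, Finset.mem_filter]
    omega
  · funext ω
    simp only [Function.comp, hτM, hτu]

namespace PriorityQueue

variable {Ω : Type*} [MeasurableSpace Ω] {P : Measure Ω} {N : ℕ} {R : Rates N}
  (Q : PriorityQueue P R)

/-- The initial situation and the paths of the clocks up to time `t`. -/
noncomputable def pastMap (t : ℝ≥0) (ω : Ω) : (QState N × (Fin N → ℝ)) × (Clock N → ℝ≥0 → ℕ) :=
  ((Q.init ω, Q.lastGen ω), fun c s => count (Q.points c) (min s t) ω)

/-- The number of points of each clock in `(t, u]`. -/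
noncomputable def increments (t u : ℝ≥0) (ω : Ω) (c : Clock N) : ℕ :=
  count (Q.points c) u ω - count (Q.points c) t ω

theorem measurable_pastMap (t : ℝ≥0) : Measurable (Q.pastMap t) :=
  (Q.measurable_init.prodMk Q.measurable_lastGen).prodMk
    (measurable_pi_lambda _ fun c => measurable_pi_lambda _ fun _ =>
      (Q.poisson c).measurable_count _)

theorem measurable_increments (t u : ℝ≥0) : Measurable (Q.increments t u) :=
  measurable_pi_lambda _ fun c =>
    ((Q.poisson c).measurable_count u).sub ((Q.poisson c).measurable_count t)

theorem iIndepFun_increments (t u : ℝ≥0) :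
    iIndepFun (fun c ω => Q.increments t u ω c) P :=
  Q.indep_clocks.comp (fun _ (w : ℝ≥0 → ℕ) => w u - w t) fun _ => by fun_prop

/-- Poisson clocks have no memory: the increments after time `t` do not depend on the past. -/
theorem indepFun_pastMap_increments [IsProbabilityMeasure P] {t u : ℝ≥0} (htu : t ≤ u) :
    IndepFun (Q.pastMap t) (Q.increments t u) P := by
  classical
  have := Fintype.ofFinite (Clock N)
  have hm : ∀ c s, Measurable (count (Q.points c) s) := fun c => (Q.poisson c).measurable_count
  refine indepFun_prodMk_left_of_indepFun
    (Y := fun ω c s => count (Q.points c) (min s t) ω)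
    (Q.measurable_init.prodMk Q.measurable_lastGen) ?_ (Q.measurable_increments t u) ?_ ?_
  · exact measurable_pi_lambda _ fun c => measurable_pi_lambda _ fun _ => hm c _
  · refine Q.indep_init.comp (φ := id)
      (ψ := fun w : Clock N → ℝ≥0 → ℕ => (fun c s => w c (min s t), fun c => w c u - w c t))
      measurable_id ?_
    fun_prop
  · -- the pair (path up to `t`, increment), indexed by `Bool`, of each clock
    set X : Clock N → Bool → Ω → (ℝ≥0 → ℕ) := fun c b ω s =>
      if b then count (Q.points c) u ω - count (Q.points c) t ω
      else count (Q.points c) (min s t) ω with hX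
    have hXm : ∀ c b, Measurable (X c b) := by
      intro c b
      refine measurable_pi_lambda _ fun s => ?_
      cases b
      · exact hm c _
      · exact (hm c u).sub (hm c t)
    have hind : iIndepFun (fun (p : Clock N × Bool) ω => X p.1 p.2 ω) P := by
      refine iIndepFun_uncurry' hXm ?_ fun c => iIndepFun_bool ?_
      · refine Q.indep_clocks.comp (fun _ (w : ℝ≥0 → ℕ) (b : Bool) (s : ℝ≥0) =>
          if b then w u - w t else w (min s t)) fun c => ?_
        refine measurable_pi_lambda _ fun b => measurable_pi_lambda _ fun s => ?_
        cases b
        · exact measurable_pi_apply _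
        · exact (measurable_pi_apply u).sub (measurable_pi_apply t)
      · exact (indepFun_path_increment (Q.poisson c).indep (hm c)
          (fun ω _ _ hab => (Q.poisson c).count_mono hab ω) (fun ω => count_zero _ ω) htu).comp
          (φ := id) (ψ := fun n _ => n) measurable_id (by fun_prop)
    have h2 := hind.indepFun_finset (Finset.univ.image fun c => (c, false))
      (Finset.univ.image fun c => (c, true)) (by
        rw [Finset.disjoint_left]
        intro p hp hp'
        simp only [Finset.mem_image, Finset.mem_univ, true_and] at hp hp'
        obtain ⟨c, rfl⟩ := hp
        obtain ⟨c', hc'⟩ := hp'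
        simp at hc') (fun p => hXm p.1 p.2)
    exact h2.comp (φ := fun w c => w ⟨(c, false), by simp⟩)
      (ψ := fun w c => w ⟨(c, true), by simp⟩ 0)
      (measurable_pi_lambda _ fun c => measurable_pi_apply _)
      (measurable_pi_lambda _ fun c =>
        (measurable_pi_apply (0 : ℝ≥0)).comp (measurable_pi_apply
          (⟨(c, true), by simp⟩ : Finset.univ.image fun c : Clock N => (c, true))))

/-- The σ-algebra of the past up to time `t`. -/
noncomputable abbrev past (t : ℝ≥0) : MeasurableSpace Ω :=
  MeasurableSpace.comap (Q.pastMap t) inferInstance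

theorem past_le (t : ℝ≥0) : Q.past t ≤ ‹MeasurableSpace Ω› :=
  measurable_iff_comap_le.1 (Q.measurable_pastMap t)

theorem measurable_past_state_fresh (i : Fin N) (t : ℝ≥0) :
    Measurable[Q.past t] (Q.state t) ∧ Measurable[Q.past t] (Q.fresh i t) := by
  have h : Measurable[Q.past t] (Q.pastMap t) := comap_measurable _
  refine Q.measurable_state_fresh i t ?_ ?_ fun c s hs => ?_
  · exact (measurable_fst.comp measurable_fst).comp h
  · exact ((measurable_pi_apply i).comp (measurable_snd.comp measurable_fst)).comp h
  · have := ((measurable_pi_apply s).comp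
      ((measurable_pi_apply c).comp measurable_snd)).comp h
    simpa only [Function.comp_def, pastMap, min_eq_left hs] using! this

/-- The event that the clock `c` has a point in `(t, u]`. -/
def rings (c : Clock N) (t u : ℝ≥0) : Set Ω := {ω | ∃ τ ∈ Q.points c ω, τ ∈ Ioc (t : ℝ) u}

theorem rings_eq (c : Clock N) {t u : ℝ≥0} (htu : t ≤ u) :
    Q.rings c t u = {ω | 0 < Q.increments t u ω c} := by
  ext ω
  simp only [rings, increments, mem_ofPred_eq, tsub_pos_iff_lt,
    (Q.poisson c).count_lt_count_iff htu]

theorem measureReal_rings_inter_rings {c c' : Clock N} (hc : c ≠ c') {t u : ℝ≥0} (htu : t ≤ u) :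
    P.real (Q.rings c t u ∩ Q.rings c' t u) =
      P.real (Q.rings c t u) * P.real (Q.rings c' t u) := by
  have := ((Q.iIndepFun_increments t u).indepFun hc).measure_inter_preimage_eq_mul _ _
    (measurableSet_Ioi (a := 0)) (measurableSet_Ioi (a := 0))
  simp only [Measure.real, Q.rings_eq _ htu, ← ENNReal.toReal_mul]
  exact congrArg ENNReal.toReal this

/-- The mean of a quantity of the past is not affected by an event that concerns the increments over
`(t, u]`. -/
theorem setIntegral_eq_of_past [IsProbabilityMeasure P] {t u : ℝ≥0} (htu : t ≤ u) {f : Ω → ℝ}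
    (hf : Measurable[Q.past t] f) {A : Set Ω}
    (hA : MeasurableSet[MeasurableSpace.comap (Q.increments t u) inferInstance] A) :
    ∫ ω in A, f ω ∂P = P.real A * ∫ ω, f ω ∂P := by
  have hind : Indep (MeasurableSpace.comap (Q.increments t u) inferInstance)
      (MeasurableSpace.comap f inferInstance) P :=
    indep_of_indep_of_le_right ((IndepFun_iff_Indep _ _ _).1
      (Q.indepFun_pastMap_increments htu)).symm (measurable_iff_comap_le.1 hf)
  exact hind.setIntegral_eq_mul (f := id)
    (measurable_iff_comap_le.1 (Q.measurable_increments t u))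
    (hf.mono (Q.past_le t) le_rfl).aemeasurable hA aestronglyMeasurable_id

theorem rate_nonneg (c : Clock N) (s : ℝ) : 0 ≤ R.rate c s := by
  cases c
  · exact R.arr_nonneg _ _
  · exact R.svc_nonneg _ _

theorem rate_intervalIntegrable (c : Clock N) (a b : ℝ) :
    IntervalIntegrable (R.rate c) volume a b := by
  have h : LocallyIntegrable (R.rate c) volume := by
    cases c
    · exact R.arr_integrable _
    · exact R.svc_integrable _
  exact (h.integrableOn_isCompact isCompact_uIcc).intervalIntegrable

theorem measureReal_rings [IsProbabilityMeasure P] (c : Clock N) {t u : ℝ≥0} (htu : t ≤ u) :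
    P.real (Q.rings c t u) = 1 - Real.exp (-∫ s in (t : ℝ)..u, R.rate c s) := by
  have hI : 0 ≤ ∫ s in (t : ℝ)..u, R.rate c s :=
    intervalIntegral.integral_nonneg (by exact_mod_cast htu) fun s _ => rate_nonneg c s
  have hc : Q.rings c t u = (Q.increments t u · c) ⁻¹' {0}ᶜ := by
    rw [Q.rings_eq c htu]
    ext ω
    simp [Nat.pos_iff_ne_zero]
  have hm : Measurable (Q.increments t u · c) :=
    (measurable_pi_apply c).comp (Q.measurable_increments t u)
  have hlaw : P.map (Q.increments t u · c) = _ := (Q.poisson c).law t u htu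
  have hPm := Measure.isProbabilityMeasure_map (μ := P) hm.aemeasurable
  rw [hc, ← map_measureReal_apply hm (by measurability), measureReal_compl (by measurability),
    hlaw, poissonMeasure_real_singleton]
  simp [Real.coe_toNNReal _ hI]

theorem tendsto_measureReal_rings_right [IsProbabilityMeasure P] (c : Clock N) (t : ℝ≥0) :
    Tendsto (fun u : ℝ≥0 => P.real (Q.rings c t u)) (𝓝[>] t) (𝓝 0) := by
  have hcont : Continuous fun u : ℝ => ∫ s in (t : ℝ)..u, R.rate c s :=
    intervalIntegral.continuous_primitive (fun a b => rate_intervalIntegrable c a b) _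
  have h : Tendsto (fun u : ℝ≥0 => 1 - Real.exp (-∫ s in (t : ℝ)..u, R.rate c s)) (𝓝 t)
      (𝓝 (1 - Real.exp (-∫ s in (t : ℝ)..t, R.rate c s))) :=
    ((Real.continuous_exp.comp (hcont.comp NNReal.continuous_coe).neg).tendsto t).const_sub 1
  simp only [intervalIntegral.integral_same, neg_zero, Real.exp_zero, sub_self] at h
  refine (h.mono_left nhdsWithin_le_nhds).congr' ?_
  filter_upwards [self_mem_nhdsWithin] with u hu using (Q.measureReal_rings c (le_of_lt hu)).symm

/-- A Poisson clock almost surely has no point at a given time. -/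
theorem ae_notMem_points [IsProbabilityMeasure P] (c : Clock N) (t : ℝ) :
    ∀ᵐ ω ∂P, t ∉ Q.points c ω := by
  rcases le_or_gt t 0 with ht | ht
  · exact Eventually.of_forall fun ω h => not_lt.2 ht ((Q.poisson c).pos ω h)
  lift t to ℝ≥0 using ht.le
  have hcont : Continuous fun s : ℝ => ∫ s in s..(t : ℝ), R.rate c s := by
    simp_rw [intervalIntegral.integral_symm (t : ℝ)]
    exact (intervalIntegral.continuous_primitive
      (fun a b => rate_intervalIntegrable c a b) _).neg
  have h : Tendsto (fun u : ℝ≥0 => 1 - Real.exp (-∫ s in (u : ℝ)..t, R.rate c s)) (𝓝 t)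
      (𝓝 (1 - Real.exp (-∫ s in (t : ℝ)..t, R.rate c s))) :=
    ((Real.continuous_exp.comp (hcont.comp NNReal.continuous_coe).neg).tendsto t).const_sub 1
  simp only [intervalIntegral.integral_same, neg_zero, Real.exp_zero, sub_self] at h
  have ht' : 0 < t := by exact_mod_cast ht
  have hne : (𝓝[<] t).NeBot := nhdsLT_neBot_of_exists_lt ⟨0, ht'⟩
  have hle : P.real {ω | (t : ℝ) ∈ Q.points c ω} ≤ 0 := by
    refine ge_of_tendsto (h.mono_left (nhdsWithin_le_nhds (s := Iio t))) ?_
    filter_upwards [self_mem_nhdsWithin] with s hs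
    have hs' : s < t := hs
    rw [← Q.measureReal_rings c hs'.le]
    exact measureReal_mono fun ω hω => ⟨t, hω, by exact_mod_cast hs', le_rfl⟩
  have h0 : P {ω | (t : ℝ) ∈ Q.points c ω} = 0 := by
    rw [← measureReal_eq_zero_iff]
    exact le_antisymm hle measureReal_nonneg
  rw [ae_iff]
  simpa using h0

end PriorityQueue

/-! ### The mean peak age -/

theorem integral_cond {Ω : Type*} [MeasurableSpace Ω] (P : Measure Ω) (E : Set Ω) (f : Ω → ℝ) :
    ∫ ω, f ω ∂(ProbabilityTheory.cond P E) = (P.real E)⁻¹ * ∫ ω in E, f ω ∂P := by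
  rw [ProbabilityTheory.cond, integral_smul_measure, ENNReal.toReal_inv, smul_eq_mul, Measure.real]

namespace PriorityQueue

variable {Ω : Type*} [MeasurableSpace Ω] {P : Measure Ω} {N : ℕ} {R : Rates N}
  (Q : PriorityQueue P R)

theorem measurable_age (i : Fin N) (t : ℝ≥0) : Measurable[Q.past t] (Q.age i t) :=
  (Q.measurable_past_state_fresh i t).2.const_sub (t : ℝ)

theorem measurableSet_inService (i : Fin N) (t : ℝ≥0) :
    MeasurableSet[Q.past t] (Q.inService i t) :=
  (Q.measurable_past_state_fresh i t).1 (QState.measurableSet_serving (some i))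

/-- Some clock other than the class-`i` service clock has a point in `(t, u]`. -/
def othersRing (i : Fin N) (t u : ℝ≥0) : Set Ω :=
  ⋃ c ∈ {c : Clock N | c ≠ .service i}, Q.rings c t u

theorem completionEvent_diff_inService_subset (i : Fin N) (t u : ℝ≥0) :
    Q.completionEvent i t u \ Q.inService i t ⊆
      Q.rings (.service i) t u ∩ Q.othersRing i t u := by
  rintro ω ⟨hE, hJ⟩
  obtain ⟨⟨τ, hτ, hτu⟩, c, hc, σ, hσ, hσu⟩ := Q.exists_other_clock_of_completion t.2 hJ hE
  exact ⟨⟨τ, hτ, Ioo_subset_Ioc_self hτu⟩,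
    mem_biUnion (show c ∈ {c : Clock N | c ≠ .service i} from hc)
      ⟨σ, hσ, Ioo_subset_Ioc_self hσu⟩⟩

theorem measurableSet_rings_increments (c : Clock N) {t u : ℝ≥0} (htu : t ≤ u) :
    MeasurableSet[MeasurableSpace.comap (Q.increments t u) inferInstance] (Q.rings c t u) := by
  rw [Q.rings_eq c htu]
  exact ⟨{d | 0 < d c}, measurable_pi_apply c measurableSet_Ioi, rfl⟩

variable [IsProbabilityMeasure P]

theorem integrable_age (i : Fin N) (t : ℝ≥0) : Integrable (Q.age i t) P := by
  refine Integrable.mono' ((integrable_const (t : ℝ)).sub (Q.integrable_lastGen i))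
    ((Q.measurable_age i t).mono (Q.past_le t) le_rfl).aestronglyMeasurable ?_
  refine Eventually.of_forall fun ω => ?_
  rw [Real.norm_of_nonneg (Q.age_nonneg (NNReal.coe_nonneg t) ω)]
  exact Q.age_le (NNReal.coe_nonneg t) ω

theorem ageLeft_ae_eq_age (i : Fin N) {t : ℝ} (ht : 0 < t) : Q.ageLeft i t =ᵐ[P] Q.age i t := by
  filter_upwards [Q.ae_notMem_points (.service i) t] with ω hω using Q.ageLeft_eq_age ht hω

/-- If class `i` is in service at time `t`, a completion before time `u` means a point of its
service clock; the end point `u` is a null event. -/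
theorem completionEvent_inter_inService_ae_eq (i : Fin N) (t u : ℝ≥0) :
    (Q.completionEvent i t u ∩ Q.inService i t : Set Ω) =ᵐ[P]
      (Q.rings (.service i) t u ∩ Q.inService i t : Set Ω) := by
  filter_upwards [Q.ae_notMem_points (.service i) u] with ω hω
  refine propext (and_congr_left fun hJ => ?_)
  refine (Q.completionEvent_iff_of_serving t.2 hJ).trans ⟨?_, ?_⟩
  · rintro ⟨τ, hτ, h1, h2⟩
    exact ⟨τ, hτ, h1, h2.le⟩
  · rintro ⟨τ, hτ, h1, h2⟩
    exact ⟨τ, hτ, h1, h2.lt_of_ne (by rintro rfl; exact hω hτ)⟩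

/-- Two clocks having points in `(t, u]` is an event of smaller order than one having a point. -/
theorem measureReal_rings_inter_othersRing_le [Fintype (Clock N)] (i : Fin N) {t u : ℝ≥0}
    (htu : t ≤ u) :
    P.real (Q.rings (.service i) t u ∩ Q.othersRing i t u) ≤
      P.real (Q.rings (.service i) t u) * ∑ c, P.real (Q.rings c t u) := by
  classical
  rw [Finset.mul_sum]
  have : Q.rings (.service i) t u ∩ Q.othersRing i t u ⊆
      ⋃ c ∈ Finset.univ.filter (fun c : Clock N => c ≠ .service i),
        Q.rings (.service i) t u ∩ Q.rings c t u := by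
    rintro ω ⟨h1, h2⟩
    simp only [othersRing, mem_iUnion] at h2
    obtain ⟨c, hc, h2⟩ := h2
    exact mem_biUnion (show c ∈ (_ : Finset (Clock N)) from by simpa using hc) ⟨h1, h2⟩
  refine (measureReal_mono this (measure_ne_top _ _)).trans
    ((measureReal_biUnion_finset_le _ _).trans ?_)
  refine (Finset.sum_congr rfl fun c hc => ?_).trans_le
    (Finset.sum_le_sum_of_subset_of_nonneg (Finset.filter_subset _ _)
      fun _ _ _ => mul_nonneg measureReal_nonneg measureReal_nonneg)
  exact Q.measureReal_rings_inter_rings (by simpa using (Finset.mem_filter.1 hc).2.symm) htu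

/-- The contribution of a nonnegative quantity `f` of the past on the event of a class-`i`
completion in `(t, u)`: up to an error of smaller order it is the probability of a point of the
service clock times the contribution of `f` on the event that class `i` is in service at time `t`.
-/
theorem abs_setIntegral_completionEvent_sub_le [Fintype (Clock N)] (i : Fin N) {t u : ℝ≥0}
    (htu : t ≤ u) {f : Ω → ℝ} (hf : Measurable[Q.past t] f) (hfi : Integrable f P)
    (hf0 : ∀ ω, 0 ≤ f ω) :
    |∫ ω in Q.completionEvent i t u, f ω ∂P -
        P.real (Q.rings (.service i) t u) * ∫ ω in Q.inService i t, f ω ∂P| ≤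
      P.real (Q.rings (.service i) t u) * ((∑ c, P.real (Q.rings c t u)) * ∫ ω, f ω ∂P) := by
  have hJ := Q.measurableSet_inService i t
  have hJ' : MeasurableSet (Q.inService i t) := Q.past_le t _ hJ
  have hA := Q.measurableSet_rings_increments (.service i) htu
  have hO : MeasurableSet[MeasurableSpace.comap (Q.increments t u) inferInstance]
      (Q.othersRing i t u) :=
    MeasurableSet.biUnion (to_countable _) fun c _ => Q.measurableSet_rings_increments c htu
  have h1 : ∫ ω in Q.completionEvent i t u ∩ Q.inService i t, f ω ∂P =
      P.real (Q.rings (.service i) t u) * ∫ ω in Q.inService i t, f ω ∂P := by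
    rw [setIntegral_congr_set (Q.completionEvent_inter_inService_ae_eq i t u),
      ← setIntegral_indicator hJ', Q.setIntegral_eq_of_past htu (hf.indicator hJ) hA,
      integral_indicator hJ']
  have h2 : ∫ ω in Q.completionEvent i t u \ Q.inService i t, f ω ∂P ≤
      P.real (Q.rings (.service i) t u) * ((∑ c, P.real (Q.rings c t u)) * ∫ ω, f ω ∂P) := by
    refine (setIntegral_mono_set hfi.integrableOn (Eventually.of_forall hf0)
      (Q.completionEvent_diff_inService_subset i t u).eventuallyLE).trans ?_
    rw [Q.setIntegral_eq_of_past htu hf (hA.inter hO), ← mul_assoc]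
    exact mul_le_mul_of_nonneg_right (Q.measureReal_rings_inter_othersRing_le i htu)
      (integral_nonneg hf0)
  rw [← integral_inter_add_sdiff hJ' hfi.integrableOn, h1, add_sub_cancel_left,
    abs_of_nonneg (integral_nonneg hf0)]
  exact h2

/-- The contribution of a quantity of the past on the event of a completion in `(t, u)`, relative to
the probability of a point of the service clock. -/
theorem tendsto_setIntegral_completionEvent_div (i : Fin N) {t : ℝ≥0} {f : Ω → ℝ}
    (hf : Measurable[Q.past t] f) (hfi : Integrable f P) (hf0 : ∀ ω, 0 ≤ f ω)
    (hpos : ∀ u, t < u → 0 < P.real (Q.rings (.service i) t u)) :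
    Tendsto (fun u : ℝ≥0 => (∫ ω in Q.completionEvent i t u, f ω ∂P) /
      P.real (Q.rings (.service i) t u)) (𝓝[>] t) (𝓝 (∫ ω in Q.inService i t, f ω ∂P)) := by
  have := Fintype.ofFinite (Clock N)
  have hlim : Tendsto (fun u : ℝ≥0 => (∑ c, P.real (Q.rings c t u)) * ∫ ω, f ω ∂P)
      (𝓝[>] t) (𝓝 0) := by
    simpa using (tendsto_finsetSum Finset.univ
      fun c _ => Q.tendsto_measureReal_rings_right c t).mul_const (∫ ω, f ω ∂P)
  rw [tendsto_iff_dist_tendsto_zero]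
  refine squeeze_zero' (Eventually.of_forall fun _ => dist_nonneg) ?_ hlim
  filter_upwards [self_mem_nhdsWithin] with u hu
  have ha := hpos u hu
  have h := Q.abs_setIntegral_completionEvent_sub_le i (le_of_lt hu) hf hfi hf0
  rw [Real.dist_eq, div_sub' ha.ne', abs_div, abs_of_pos ha, div_le_iff₀ ha, mul_comm (_ * _)]
  exact h

/-- A class-`i` completion can follow time `t` immediately only if the class-`i` service clock can
have points there. -/
theorem measureReal_rings_pos (i : Fin N) {t u : ℝ≥0}
    (h : 0 < P (Q.completionEvent i t u)) : 0 < P.real (Q.rings (.service i) t u) := by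
  refine (measureReal_nonneg.lt_of_ne fun h0 => h.ne' ?_)
  rw [eq_comm, measureReal_eq_zero_iff] at h0
  refine measure_mono_null ?_ h0
  rintro ω ⟨x, hx, hxu⟩
  exact ⟨x.2, hx.1, Ioo_subset_Ioc_self hxu⟩

/-- The mean peak age is the mean age given that class `i` is in service. -/
theorem hasMeanPeakAge (i : Fin N) {t : ℝ≥0} (ht : 0 < t)
    (hE : ∀ h : ℝ, 0 < h → 0 < P (Q.completionEvent i t (t + h)))
    (hπ : 0 < Q.serviceProb i t) :
    Q.HasMeanPeakAge i t ((∫ ω in Q.inService i t, Q.age i t ω ∂P) / Q.serviceProb i t) := by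
  have hpos : ∀ u, t < u → 0 < P.real (Q.rings (.service i) t u) := fun u hu => by
    refine Q.measureReal_rings_pos i ?_
    have := hE (u - t) (sub_pos.2 (by exact_mod_cast hu))
    rwa [add_sub_cancel] at this
  have h1 := Q.tendsto_setIntegral_completionEvent_div i (Q.measurable_age i t)
    (Q.integrable_age i t) (Q.age_nonneg (NNReal.coe_nonneg t)) hpos
  have h2 := Q.tendsto_setIntegral_completionEvent_div i (t := t) (f := fun _ => 1)
    measurable_const (integrable_const 1) (fun _ => zero_le_one) hpos
  simp only [setIntegral_const, smul_eq_mul, mul_one] at h2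
  -- `f = age` and `f = 1` give the numerator and the denominator of the conditional mean
  have h3 := h1.div h2 hπ.ne'
  have hmap : Tendsto (fun h : ℝ => (t : ℝ≥0) + h.toNNReal) (𝓝[>] 0) (𝓝[>] t) := by
    refine tendsto_nhdsWithin_iff.2 ⟨?_, ?_⟩
    · have : Tendsto (fun h : ℝ => t + h.toNNReal) (𝓝 0) (𝓝 (t + (0 : ℝ).toNNReal)) :=
        (continuous_const.add continuous_real_toNNReal).tendsto 0
      rw [Real.toNNReal_zero, add_zero] at this
      exact this.mono_left nhdsWithin_le_nhds
    · filter_upwards [self_mem_nhdsWithin] with h hh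
      simpa using hh
  refine (h3.comp hmap).congr' ?_
  filter_upwards [self_mem_nhdsWithin] with h hh
  have hh' : ((t + h.toNNReal : ℝ≥0) : ℝ) = t + h := by
    rw [NNReal.coe_add, Real.coe_toNNReal _ (le_of_lt hh)]
  have ha := (hpos (t + h.toNNReal) (by simpa using hh)).ne'
  simp only [Function.comp, Pi.div_apply]
  rw [div_div_div_cancel_right₀ ha, integral_cond, hh', div_eq_inv_mul]
  congr 1
  exact (integral_congr_ae (ae_restrict_of_ae (Q.ageLeft_ae_eq_age i
    (NNReal.coe_pos.2 ht)))).symm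

/-- The gap formula: the mean age is the average, with weights `π` and `1 - π`, of the mean ages
given that class `i` is or is not in service, and the former is the mean peak age. -/
theorem meanPeakAge_sub_meanAge (i : Fin N) {t : ℝ≥0} (ht : 0 < t)
    (hE : ∀ h : ℝ, 0 < h → 0 < P (Q.completionEvent i t (t + h))) {d : ℝ}
    (hd : Q.HasMeanPeakAge i t d) :
    d - Q.meanAge i t = (1 - Q.serviceProb i t) * (d - Q.unservedMeanAge i t) := by
  have hJ : MeasurableSet (Q.inService i t) := Q.past_le t _ (Q.measurableSet_inService i t)
  -- total expectation over the events that class `i` is or is not in service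
  have hsplit := integral_add_compl hJ (Q.integrable_age i t)
  have hcompl : P.real (Q.inService i t)ᶜ = 1 - Q.serviceProb i t := probReal_compl_eq_one_sub hJ
  have hd' : Q.serviceProb i t * d = ∫ ω in Q.inService i t, Q.age i t ω ∂P := by
    rcases (show 0 ≤ Q.serviceProb i t from measureReal_nonneg).eq_or_lt with h0 | hpos
    -- for a class that is almost surely not in service both sides vanish, whatever `d` is
    · rw [← h0, zero_mul, setIntegral_measure_zero]
      exact (measureReal_eq_zero_iff).1 h0.symm
    · rw [tendsto_nhds_unique hd (Q.hasMeanPeakAge i ht hE hpos), mul_div_cancel₀ _ hpos.ne']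
  rw [unservedMeanAge, integral_cond, hcompl, meanAge, ← hsplit, ← hd']
  by_cases h1 : 1 - Q.serviceProb i t = 0
  -- here the conditional mean is undefined, but it is multiplied by `0`
  · have h0 : ∫ ω in (Q.inService i t)ᶜ, Q.age i t ω ∂P = 0 :=
      setIntegral_measure_zero _ ((measureReal_eq_zero_iff).1 (hcompl.trans h1))
    rw [h0, h1, ← sub_eq_zero.1 h1]
    ring
  · field_simp
    ring

end PriorityQueue

/-! ### Construction of Poisson processes -/

section PoissonConstruction

/-- Probability generating function of a Poisson variable, on the closed unit disc. -/
theorem integral_pow_poissonMeasure (m : ℝ≥0) (z : ℂ) :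
    ∫ n, z ^ n ∂(poissonMeasure m) = Complex.exp (m * (z - 1)) := by
  rw [integral_poissonMeasure]
  calc ∑' n : ℕ, (Real.exp (-m) * m ^ n / n.factorial : ℝ) • z ^ n
      = ∑' n : ℕ, (Real.exp (-m) : ℂ) * ((m * z) ^ n / n.factorial) := by
        congr with n
        rw [Complex.real_smul]
        push_cast
        rw [mul_pow]
        ring
    _ = Real.exp (-m) * Complex.exp (m * z) := by
        rw [tsum_mul_left, (NormedSpace.expSeries_div_hasSum_exp (m * z : ℂ)).tsum_eq,
          Complex.exp_eq_exp_ℂ]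
    _ = Complex.exp (m * (z - 1)) := by
        rw [Complex.ofReal_exp, ← Complex.exp_add]
        push_cast
        ring_nf

/-- The unit cells of the half-line. -/
def cell (k : ℕ) : Set ℝ := Ioc (k : ℝ) (k + 1)

theorem measurableSet_cell (k : ℕ) : MeasurableSet (cell k) := measurableSet_Ioc

open Classical in
/-- The law of a single point in the `k`-th cell, under the intensity measure `ν`; an arbitrary
law if the cell has mass zero, when it has no points. -/
noncomputable def pointLaw (ν : Measure ℝ) (k : ℕ) : Measure ℝ :=
  if ν (cell k) = 0 then Measure.dirac 0 else ProbabilityTheory.cond ν (cell k)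

variable (ν : Measure ℝ) [IsLocallyFiniteMeasure ν]

theorem measure_cell_ne_top (k : ℕ) : ν (cell k) ≠ ∞ :=
  (measure_Ioc_lt_top (μ := ν)).ne

instance (k : ℕ) : IsProbabilityMeasure (pointLaw ν k) := by
  unfold pointLaw
  split_ifs with h
  · infer_instance
  · exact cond_isProbabilityMeasure_of_finite h (measure_cell_ne_top ν k)

/-- Sample space for a Poisson process: for each cell the number of points, and an infinite supply
of positions, of which only that many are used. -/
abbrev PoissonSpace : Type := ℕ → ℕ × (ℕ → ℝ)

/-- The number of points in a cell and their positions: a Poisson number of independent points. -/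
noncomputable def cellMeasure (k : ℕ) : Measure (ℕ × (ℕ → ℝ)) :=
  (poissonMeasure (ν (cell k)).toNNReal).prod (Measure.infinitePi fun _ => pointLaw ν k)

instance (k : ℕ) : IsProbabilityMeasure (cellMeasure ν k) := by
  unfold cellMeasure; infer_instance

/-- The cells are independent. -/
noncomputable def poissonSpaceMeasure : Measure PoissonSpace :=
  Measure.infinitePi (cellMeasure ν)

instance : IsProbabilityMeasure (poissonSpaceMeasure ν) := by
  unfold poissonSpaceMeasure; infer_instance

theorem measurable_sum_range {M : Type*} [AddCommMonoid M] [MeasurableSpace M] [MeasurableAdd₂ M]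
    {g : ℝ → M} (hg : Measurable g) :
    Measurable fun p : ℕ × (ℕ → ℝ) => ∑ j ∈ Finset.range p.1, g (p.2 j) :=
  measurable_from_prod_countable_right fun n =>
    Finset.measurable_fun_sum (Finset.range n) fun j _ => hg.comp (measurable_pi_apply j)

theorem measurable_prod_range {g : ℝ → ℂ} (hg : Measurable g) :
    Measurable fun p : ℕ × (ℕ → ℝ) => ∏ j ∈ Finset.range p.1, g (p.2 j) :=
  measurable_from_prod_countable_right fun n =>
    Finset.measurable_fun_prod (Finset.range n) fun j _ => hg.comp (measurable_pi_apply j)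

theorem integral_prod_range_infinitePi {X : ℕ → Type*} [∀ i, MeasurableSpace (X i)]
    (κ : ∀ i, Measure (X i)) [∀ i, IsProbabilityMeasure (κ i)] {g : ∀ i, X i → ℂ}
    (hg : ∀ i, Measurable (g i)) (n : ℕ) :
    ∫ x, ∏ j ∈ Finset.range n, g j (x j) ∂(Measure.infinitePi κ) =
      ∏ j ∈ Finset.range n, ∫ y, g j y ∂(κ j) := by
  have hind := (iIndepFun_infinitePi (P := κ) hg).precomp (g := fun j : Fin n => j.1)
    Fin.val_injective
  have := hind.integral_fun_prod_eq_prod_integral fun j =>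
    ((hg j.1).comp (measurable_pi_apply _)).aestronglyMeasurable
  simp only [Finset.prod_range]
  rw [this]
  refine Finset.prod_congr rfl fun j _ => ?_
  conv_rhs => rw [← Measure.infinitePi_map_eval κ j.1]
  rw [integral_map (measurable_pi_apply _).aemeasurable (hg _).aestronglyMeasurable]

theorem integral_prod_points_cell {g : ℝ → ℂ} (hg : Measurable g) (hg1 : ∀ x, ‖g x‖ ≤ 1) (k : ℕ) :
    ∫ p, ∏ j ∈ Finset.range p.1, g (p.2 j) ∂(cellMeasure ν k) =
      Complex.exp (∫ x in cell k, (g x - 1) ∂ν) := by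
  have hb : ∀ p : ℕ × (ℕ → ℝ), ‖∏ j ∈ Finset.range p.1, g (p.2 j)‖ ≤ 1 := fun p => by
    rw [norm_prod]
    exact Finset.prod_le_one (fun _ _ => norm_nonneg _) fun _ _ => hg1 _
  have hint : Integrable (fun p : ℕ × (ℕ → ℝ) => ∏ j ∈ Finset.range p.1, g (p.2 j))
      (cellMeasure ν k) :=
    Integrable.of_bound (measurable_prod_range hg).aestronglyMeasurable 1
      (Eventually.of_forall hb)
  rw [cellMeasure] at hint ⊢
  rw [integral_prod _ hint]
  simp only [integral_prod_range_infinitePi (fun _ => pointLaw ν k) (fun _ => hg),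
    Finset.prod_const, Finset.card_range]
  rw [integral_pow_poissonMeasure]
  congr 1
  have hfin : IsFiniteMeasure (ν.restrict (cell k)) :=
    ⟨by simpa using (measure_cell_ne_top ν k).lt_top⟩
  have hgi : Integrable g (ν.restrict (cell k)) :=
    Integrable.of_bound hg.aestronglyMeasurable 1 (Eventually.of_forall hg1)
  rw [integral_sub hgi (integrable_const 1), setIntegral_const]
  have hm : ((ν (cell k)).toNNReal : ℂ) = ((ν.real (cell k) : ℝ) : ℂ) := rfl
  rw [hm, pointLaw]
  split_ifs with h
  · have h' : ν.real (cell k) = 0 := by simp [Measure.real, h]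
    rw [h', setIntegral_measure_zero _ h]
    simp
  · have h' : (ν.real (cell k) : ℂ) ≠ 0 := by
      exact_mod_cast (ENNReal.toReal_ne_zero.2 ⟨h, measure_cell_ne_top ν k⟩)
    rw [ProbabilityTheory.cond, integral_smul_measure, ENNReal.toReal_inv, Complex.real_smul,
      Complex.real_smul, mul_sub, Complex.ofReal_inv, ← Measure.real, mul_one,
      mul_inv_cancel_left₀ h']

theorem iUnion_cell (K : ℕ) : ⋃ k ∈ Finset.range K, cell k = Ioc (0 : ℝ) K := by
  ext x
  simp only [Finset.mem_range, mem_iUnion, cell, exists_prop, mem_Ioc]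
  constructor
  · rintro ⟨k, hk, h1, h2⟩
    refine ⟨(Nat.cast_nonneg k).trans_lt h1, h2.trans ?_⟩
    exact_mod_cast Nat.succ_le_of_lt hk
  · rintro ⟨h1, h2⟩
    have hpos : 0 < ⌈x⌉₊ := Nat.ceil_pos.2 h1
    refine ⟨⌈x⌉₊ - 1, ?_, ?_, ?_⟩
    · have := Nat.ceil_le.2 h2
      omega
    · exact Nat.lt_ceil.1 (by omega)
    · have : ((⌈x⌉₊ - 1 : ℕ) : ℝ) + 1 = ⌈x⌉₊ := by
        exact_mod_cast Nat.sub_add_cancel hpos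
      rw [this]
      exact Nat.le_ceil x

theorem pairwise_disjoint_cell : Pairwise (Function.onFun Disjoint cell) := by
  have h : ∀ a b : ℕ, a < b → Disjoint (cell a) (cell b) := fun a b hab => by
    have : (a : ℝ) + 1 ≤ b := by exact_mod_cast hab
    exact Set.disjoint_left.2 fun x h1 h2 => not_lt.2 (h1.2.trans this) h2.1
  intro a b hab
  rcases lt_or_gt_of_ne hab with h' | h'
  · exact h a b h'
  · exact (h b a h').symm

/-- Campbell's formula for the points in the first `K` cells: the characteristic functional of the
point process. -/
theorem integral_prod_points {g : ℝ → ℂ} (hg : Measurable g) (hg1 : ∀ x, ‖g x‖ ≤ 1) (K : ℕ) :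
    ∫ ω, ∏ k ∈ Finset.range K, ∏ j ∈ Finset.range (ω k).1, g ((ω k).2 j)
        ∂(poissonSpaceMeasure ν) =
      Complex.exp (∫ x in Ioc (0 : ℝ) K, (g x - 1) ∂ν) := by
  rw [poissonSpaceMeasure, integral_prod_range_infinitePi (cellMeasure ν)
    (g := fun _ p => ∏ j ∈ Finset.range p.1, g (p.2 j)) (fun _ => measurable_prod_range hg)]
  simp only [integral_prod_points_cell ν hg hg1]
  rw [← Complex.exp_sum, ← iUnion_cell, integral_biUnion_finset]
  · exact fun k _ => measurableSet_cell k
  · exact fun a _ b _ hab => pairwise_disjoint_cell hab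
  · intro k _
    have hfin : IsFiniteMeasure (ν.restrict (cell k)) :=
      ⟨by simpa using (measure_cell_ne_top ν k).lt_top⟩
    exact (Integrable.of_bound hg.aestronglyMeasurable 1 (Eventually.of_forall hg1)).sub
      (integrable_const 1)

/-- The samples without exceptional behaviour: all the points lie in their cells and in `S`, and
they are distinct. -/
def goodSamples (S : Set ℝ) : Set PoissonSpace :=
  {ω | (∀ k j, j < (ω k).1 → (ω k).2 j ∈ cell k ∩ S) ∧
    ∀ k j j', j < (ω k).1 → j' < (ω k).1 → (ω k).2 j = (ω k).2 j' → j = j'}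

theorem measurableSet_goodSamples {S : Set ℝ} (hS : MeasurableSet S) :
    MeasurableSet (goodSamples S) := by
  have h1 : ∀ k j, Measurable fun ω : PoissonSpace => j < (ω k).1 := fun k j =>
    measurableSet_setOfPred.1 (measurableSet_lt measurable_const (by fun_prop))
  have hx : ∀ k j, Measurable fun ω : PoissonSpace => (ω k).2 j := fun k j => by fun_prop
  refine measurableSet_setOfPred.2 (Measurable.and ?_ ?_)
  · exact Measurable.forall fun k => Measurable.forall fun j => (h1 k j).imp
      (measurableSet_setOfPred.1 ((hx k j) ((measurableSet_cell k).inter hS)))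
  · exact Measurable.forall fun k => Measurable.forall fun j => Measurable.forall fun j' =>
      (h1 k j).imp ((h1 k j').imp ((measurableSet_setOfPred.1
        (measurableSet_eq_fun (hx k j) (hx k j'))).imp measurable_const))

theorem ae_of_ae_cellMeasure {k : ℕ} {p : ℕ × (ℕ → ℝ) → Prop} (h : ∀ᵐ x ∂(cellMeasure ν k), p x) :
    ∀ᵐ ω ∂(poissonSpaceMeasure ν), p (ω k) :=
  (measurePreserving_eval_infinitePi (cellMeasure ν) k).quasiMeasurePreserving.ae h

theorem ae_of_ae_positions {k : ℕ} {p : (ℕ → ℝ) → Prop}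
    (h : ∀ᵐ x ∂(Measure.infinitePi fun _ : ℕ => pointLaw ν k), p x) :
    ∀ᵐ ω ∂(poissonSpaceMeasure ν), p (ω k).2 :=
  ae_of_ae_cellMeasure ν (p := fun x => p x.2)
    (measurePreserving_snd.quasiMeasurePreserving.ae h)

theorem ae_mem_goodSamples [NullSingletonClass ν] {S : Set ℝ} (hνS : ν Sᶜ = 0) :
    ∀ᵐ ω ∂(poissonSpaceMeasure ν), ω ∈ goodSamples S := by
  -- a cell of zero mass contains no points
  have hzero : ∀ k, ν (cell k) = 0 → ∀ᵐ ω ∂(poissonSpaceMeasure ν), (ω k).1 = 0 := by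
    intro k hk
    refine ae_of_ae_cellMeasure ν (p := fun x => x.1 = 0) ?_
    refine measurePreserving_fst.quasiMeasurePreserving.ae (p := fun n => n = 0) ?_
    rw [hk, ENNReal.toNNReal_zero]
    refine (prob_compl_eq_zero_iff (measurableSet_singleton 0)).2 ?_
    simp [poissonMeasure_singleton]
  refine (ae_all_iff.2 fun k => ?_).and (ae_all_iff.2 fun k => ?_)
  all_goals by_cases hk : ν (cell k) = 0
  · filter_upwards [hzero k hk] with ω hω j hj
    omega
  · refine ae_all_iff.2 fun j => ?_
    have h1 : ∀ᵐ x ∂(pointLaw ν k), x ∈ cell k ∩ S := by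
      rw [pointLaw, if_neg hk]
      have h2 : ∀ᵐ x ∂ν, x ∈ S := hνS
      filter_upwards [ae_cond_mem (measurableSet_cell k),
        cond_absolutelyContinuous.ae_le h2] with x h3 h4 using ⟨h3, h4⟩
    have h2 := ae_of_ae_positions ν (k := k) (p := fun x => x j ∈ cell k ∩ S)
      ((measurePreserving_eval_infinitePi (fun _ : ℕ => pointLaw ν k) j).quasiMeasurePreserving.ae
        h1)
    filter_upwards [h2] with ω hω _ using hω
  · filter_upwards [hzero k hk] with ω hω j j' hj
    omega
  · refine ae_all_iff.2 fun j => ae_all_iff.2 fun j' => ?_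
    by_cases hj : j = j'
    · exact Eventually.of_forall fun ω _ _ _ => hj
    have hna : NullSingletonClass (pointLaw ν k) := by
      refine ⟨fun x => ?_⟩
      rw [pointLaw, if_neg hk]
      exact cond_absolutelyContinuous (measure_singleton x)
    have h1 : ∀ᵐ x ∂((pointLaw ν k).prod (pointLaw ν k)), x.1 ≠ x.2 := by
      have hd : MeasurableSet {x : ℝ × ℝ | x.1 = x.2} :=
        measurableSet_eq_fun measurable_fst measurable_snd
      have h0 : ((pointLaw ν k).prod (pointLaw ν k)) {x : ℝ × ℝ | x.1 = x.2} = 0 := by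
        refine (Measure.measure_prod_null hd).2 (Eventually.of_forall fun x => ?_)
        have : Prod.mk x ⁻¹' {x : ℝ × ℝ | x.1 = x.2} = {x} := by
          ext y; simp [eq_comm]
        exact (congrArg (pointLaw ν k) this).trans (measure_singleton x)
      rw [ae_iff]
      simpa using h0
    have h2 := ae_of_ae_positions ν (k := k) (p := fun x => x j ≠ x j') (by
      rw [← Measure.infinitePi_map_eval_prod (P := fun _ : ℕ => pointLaw ν k) hj] at h1
      exact ae_of_ae_map (p := fun x : ℝ × ℝ => x.1 ≠ x.2) (by fun_prop) h1)
    filter_upwards [h2] with ω hω _ _ h using absurd h hω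

/-- The Poisson points: the union over the cells of the points in the cell. Exceptional samples are
given no points at all, which makes the points lie in `S` for every sample. -/
def poissonPoints (S : Set ℝ) (ω : PoissonSpace) : Set ℝ :=
  {x | ω ∈ goodSamples S ∧ ∃ k j, j < (ω k).1 ∧ (ω k).2 j = x}

open Classical in
/-- The number of points in `(s, t]` that belong to the first `K` cells. -/
noncomputable def countBetween (s t : ℝ) (K : ℕ) (ω : PoissonSpace) : ℕ :=
  ∑ k ∈ Finset.range K, ∑ j ∈ Finset.range (ω k).1, if (ω k).2 j ∈ Ioc s t then 1 else 0

theorem measurable_countBetween (s t : ℝ) (K : ℕ) : Measurable (countBetween s t K) := by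
  classical
  refine Finset.measurable_fun_sum _ fun k _ => ?_
  exact (measurable_sum_range (g := fun x => if x ∈ Ioc s t then 1 else 0)
    (Measurable.ite measurableSet_Ioc measurable_const measurable_const)).comp
      (measurable_pi_apply k)

open Classical in
theorem poissonPoints_inter_Ioc {S : Set ℝ} {ω : PoissonSpace} (hω : ω ∈ goodSamples S) {t : ℝ}
    {K : ℕ} (hK : t ≤ K) :
    poissonPoints S ω ∩ Ioc 0 t =
      (fun p : (_ : ℕ) × ℕ => (ω p.1).2 p.2) ''
        (((Finset.range K).sigma fun k => Finset.range (ω k).1).filter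
          fun p => (ω p.1).2 p.2 ∈ Ioc 0 t : Finset ((_ : ℕ) × ℕ)) := by
  ext x
  simp only [poissonPoints, mem_inter_iff, mem_ofPred_eq, hω, true_and, mem_image,
    Finset.coe_filter, Finset.mem_sigma, Finset.mem_range, Sigma.exists]
  constructor
  · rintro ⟨⟨k, j, hj, rfl⟩, hx⟩
    refine ⟨k, j, ⟨⟨?_, hj⟩, hx⟩, rfl⟩
    have := ((hω.1 k j hj).1.1.trans_le hx.2).trans_le hK
    exact_mod_cast this
  · rintro ⟨k, j, ⟨⟨-, hj⟩, hx⟩, rfl⟩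
    exact ⟨⟨k, j, hj, rfl⟩, hx⟩

theorem count_poissonPoints {S : Set ℝ} {ω : PoissonSpace} (hω : ω ∈ goodSamples S) {t : ℝ≥0}
    {K : ℕ} (hK : t ≤ K) : count (poissonPoints S) t ω = countBetween 0 t K ω := by
  classical
  rw [count, poissonPoints_inter_Ioc hω (t := t) (K := K) (by exact_mod_cast hK),
    Set.InjOn.ncard_image, Set.ncard_coe_finset, Finset.card_filter, Finset.sum_sigma]
  · rfl
  · rintro ⟨k, j⟩ hp ⟨k', j'⟩ hp' h
    simp only [Finset.coe_filter, Finset.mem_sigma, Finset.mem_range, mem_ofPred_eq] at hp hp' h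
    have hkk : k = k' := by
      by_contra hne
      exact Set.disjoint_left.1 (pairwise_disjoint_cell hne) (hω.1 k j hp.1.2).1
        (h ▸ (hω.1 k' j' hp'.1.2).1)
    subst hkk
    rw [hω.2 k j j' hp.1.2 hp'.1.2 h]

theorem count_sub_count_poissonPoints {S : Set ℝ} {ω : PoissonSpace} (hω : ω ∈ goodSamples S)
    {s t : ℝ≥0} (hst : s ≤ t) {K : ℕ} (hK : t ≤ K) :
    count (poissonPoints S) t ω - count (poissonPoints S) s ω = countBetween s t K ω := by
  rw [count_poissonPoints hω hK, count_poissonPoints hω (hst.trans hK)]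
  refine Nat.sub_eq_of_eq_add ?_
  simp only [countBetween, ← Finset.sum_add_distrib]
  refine Finset.sum_congr rfl fun k _ => Finset.sum_congr rfl fun j _ => ?_
  have hs : (0 : ℝ) ≤ s := s.2
  have hst' : (s : ℝ) ≤ t := by exact_mod_cast hst
  simp only [mem_Ioc]
  split_ifs <;> grind

theorem measurable_count_poissonPoints {S : Set ℝ} (hS : MeasurableSet S) (t : ℝ≥0) :
    Measurable (count (poissonPoints S) t) := by
  classical
  have : count (poissonPoints S) t =
      fun ω => if ω ∈ goodSamples S then countBetween 0 t ⌈t⌉₊ ω else 0 := by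
    funext ω
    split_ifs with h
    · exact count_poissonPoints h (Nat.le_ceil t)
    · simp [count, poissonPoints, h]
  rw [this]
  exact Measurable.ite (measurableSet_goodSamples hS) (measurable_countBetween _ _ _)
    measurable_const

/-- The joint characteristic function of the numbers of points in consecutive intervals. -/
theorem integral_exp_sum_countBetween {n : ℕ} {τ : Fin (n + 1) → ℝ≥0} (hτ : Monotone τ) {K : ℕ}
    (hK : ∀ i, τ i ≤ K) (θ : Fin n → ℝ) :
    ∫ ω, Complex.exp (∑ i, θ i * (countBetween (τ i.castSucc) (τ i.succ) K ω : ℝ) * Complex.I)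
        ∂(poissonSpaceMeasure ν) =
      Complex.exp (∑ i, ν.real (Ioc (τ i.castSucc : ℝ) (τ i.succ)) *
        (Complex.exp (θ i * Complex.I) - 1)) := by
  classical
  set I : Fin n → Set ℝ := fun i => Ioc (τ i.castSucc : ℝ) (τ i.succ) with hI
  set g : ℝ → ℂ := fun x => Complex.exp (∑ i, θ i * (if x ∈ I i then 1 else 0 : ℝ) * Complex.I)
    with hg
  have hgm : Measurable g := by
    refine Complex.measurable_exp.comp (Finset.measurable_fun_sum _ fun i _ => ?_)
    refine (measurable_const.mul (Complex.measurable_ofReal.comp ?_)).mul_const _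
    exact Measurable.ite measurableSet_Ioc measurable_const measurable_const
  have hg1 : ∀ x, ‖g x‖ ≤ 1 := fun x => by
    have : (∑ i, θ i * (if x ∈ I i then 1 else 0 : ℝ) * Complex.I : ℂ) =
        ((∑ i, θ i * (if x ∈ I i then 1 else 0 : ℝ) : ℝ) : ℂ) * Complex.I := by
      push_cast
      rw [Finset.sum_mul]
    rw [hg]
    simp only
    rw [this, Complex.norm_exp_ofReal_mul_I]
  have hdisj : ∀ i j x, x ∈ I i → x ∈ I j → i = j := by
    have h : ∀ i j x, i < j → x ∈ I i → x ∉ I j := by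
      intro i j x hij hi hj
      have h1 : τ i.succ ≤ τ j.castSucc := hτ (by
        rw [Fin.le_def]; simp only [Fin.val_succ, Fin.val_castSucc]; exact hij)
      have h2 : (τ i.succ : ℝ) ≤ τ j.castSucc := by exact_mod_cast h1
      exact not_lt.2 (hi.2.trans h2) hj.1
    intro i j x hi hj
    rcases lt_trichotomy i j with h' | h' | h'
    · exact absurd hj (h i j x h' hi)
    · exact h'
    · exact absurd hi (h j i x h' hj)
  have hgsub : ∀ x, g x - 1 =
      ∑ i, (I i).indicator (fun _ => Complex.exp (θ i * Complex.I) - 1) x := by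
    intro x
    by_cases hx : ∃ i, x ∈ I i
    · obtain ⟨i, hi⟩ := hx
      have hne : ∀ j, j ≠ i → x ∉ I j := fun j hj h => hj (hdisj j i x h hi)
      rw [Finset.sum_eq_single i (fun j _ hj => by simp [hne j hj]) (by simp), hg]
      simp only
      rw [Finset.sum_eq_single i (fun j _ hj => by simp [hne j hj]) (by simp)]
      simp [hi]
    · push Not at hx
      simp [hg, hx]
  have hprod : ∀ ω : PoissonSpace,
      Complex.exp (∑ i, θ i * (countBetween (τ i.castSucc) (τ i.succ) K ω : ℝ) * Complex.I) =
        ∏ k ∈ Finset.range K, ∏ j ∈ Finset.range (ω k).1, g ((ω k).2 j) := by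
    intro ω
    simp only [hg, ← Complex.exp_sum]
    congr 1
    simp only [countBetween]
    push_cast
    simp only [Finset.mul_sum, Finset.sum_mul]
    rw [Finset.sum_comm]
    refine Finset.sum_congr rfl fun k _ => ?_
    rw [Finset.sum_comm]
  simp only [hprod]
  rw [integral_prod_points ν hgm hg1]
  congr 1
  simp only [hgsub]
  rw [integral_finsetSum]
  · refine Finset.sum_congr rfl fun i _ => ?_
    rw [integral_indicator measurableSet_Ioc, setIntegral_const, Complex.real_smul]
    congr 2
    rw [measureReal_restrict_apply measurableSet_Ioc]
    congr 1
    refine inter_eq_left.2 (Ioc_subset_Ioc (τ _).2 ?_)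
    exact_mod_cast hK _
  · intro i _
    have hfin : IsFiniteMeasure (ν.restrict (Ioc (0 : ℝ) K)) :=
      ⟨by simpa using measure_Ioc_lt_top (μ := ν)⟩
    exact (integrable_const _).indicator measurableSet_Ioc

/-- The joint characteristic function of the increments over consecutive intervals is that of
independent Poisson variables. -/
theorem charFun_count_poissonPoints [NullSingletonClass ν] {S : Set ℝ}
    (hνS : ν Sᶜ = 0) {n : ℕ} {τ : Fin (n + 1) → ℝ≥0} (hτ : Monotone τ) (θ : Fin n → ℝ) :
    ∫ ω, Complex.exp (∑ i, θ i * ((count (poissonPoints S) (τ i.succ) ω -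
        count (poissonPoints S) (τ i.castSucc) ω : ℕ) : ℝ) * Complex.I)
        ∂(poissonSpaceMeasure ν) =
      Complex.exp (∑ i, ν.real (Ioc (τ i.castSucc : ℝ) (τ i.succ)) *
        (Complex.exp (θ i * Complex.I) - 1)) := by
  have hK : ∀ i, τ i ≤ (⌈τ (Fin.last n)⌉₊ : ℝ≥0) := fun i =>
    (hτ (Fin.le_last i)).trans (Nat.le_ceil _)
  rw [← integral_exp_sum_countBetween ν hτ hK]
  refine integral_congr_ae ?_
  filter_upwards [ae_mem_goodSamples ν hνS] with ω hω
  simp only [count_sub_count_poissonPoints hω (hτ (Fin.castSucc_lt_succ.le)) (hK _)]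

theorem map_count_poissonPoints [NullSingletonClass ν] {S : Set ℝ} (hS : MeasurableSet S)
    (hνS : ν Sᶜ = 0) {s t : ℝ≥0} (hst : s ≤ t) :
    (poissonSpaceMeasure ν).map
        (fun ω => count (poissonPoints S) t ω - count (poissonPoints S) s ω) =
      poissonMeasure (ν.real (Ioc (s : ℝ) t)).toNNReal := by
  have hD : Measurable fun ω => count (poissonPoints S) t ω - count (poissonPoints S) s ω :=
    (measurable_count_poissonPoints hS t).sub (measurable_count_poissonPoints hS s)
  have hcast : Measurable (Nat.cast : ℕ → ℝ) := measurable_of_countable _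
  have key : ((poissonSpaceMeasure ν).map
        (fun ω => count (poissonPoints S) t ω - count (poissonPoints S) s ω)).map
          (Nat.cast : ℕ → ℝ) =
      (poissonMeasure (ν.real (Ioc (s : ℝ) t)).toNNReal).map (Nat.cast : ℕ → ℝ) := by
    have := Measure.isProbabilityMeasure_map (μ := poissonSpaceMeasure ν) hD.aemeasurable
    have := Measure.isProbabilityMeasure_map (μ := (poissonSpaceMeasure ν).map
        (fun ω => count (poissonPoints S) t ω - count (poissonPoints S) s ω)) hcast.aemeasurable
    refine Measure.ext_of_charFun (funext fun θ => ?_)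
    rw [charFun_map_cast_poissonMeasure, Real.coe_toNNReal _ measureReal_nonneg,
      Measure.map_map hcast hD, charFun_apply_real,
      integral_map (hcast.comp hD).aemeasurable (by fun_prop)]
    have h := charFun_count_poissonPoints ν hνS (n := 1) (τ := ![s, t])
      (Fin.monotone_iff_le_succ.2 fun i => by
        have : i = 0 := Subsingleton.elim _ _
        subst this
        simpa using hst) (fun _ => θ)
    simpa using h
  have h := congrArg (Measure.map (Nat.floor : ℝ → ℕ)) key
  rw [Measure.map_map Nat.measurable_floor hcast, Measure.map_map Nat.measurable_floor hcast] at h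
  have hid : (Nat.floor : ℝ → ℕ) ∘ Nat.cast = id := funext fun n => Nat.floor_natCast n
  rwa [hid, Measure.map_id, Measure.map_id] at h

/-- Independence from a factorization of the joint characteristic function. -/
theorem iIndepFun_of_integral_exp_sum {Ω : Type*} [MeasurableSpace Ω] {P : Measure Ω}
    [IsProbabilityMeasure P] {n : ℕ} {Y : Fin n → Ω → ℝ} (hY : ∀ i, Measurable (Y i))
    (h : ∀ θ : Fin n → ℝ, ∫ ω, Complex.exp (∑ i, θ i * (Y i ω : ℂ) * Complex.I) ∂P =
      ∏ i, charFun (P.map (Y i)) (θ i)) : iIndepFun Y P := by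
  refine (iIndepFun_iff_charFun_pi fun i => (hY i).aemeasurable).2 fun θ => ?_
  have hm : Measurable fun ω => WithLp.toLp 2 fun i => Y i ω :=
    (WithLp.measurable_toLp 2 _).comp (measurable_pi_lambda _ hY)
  rw [← h, charFun_apply, integral_map hm.aemeasurable (by fun_prop)]
  refine integral_congr_ae (Eventually.of_forall fun ω => ?_)
  simp only [PiLp.inner_apply, Real.inner_apply]
  push_cast
  rw [Finset.sum_mul]
  refine congrArg _ (Finset.sum_congr rfl fun i _ => ?_)
  ring

theorem hasIndepIncrements_poissonPoints [NullSingletonClass ν] {S : Set ℝ} (hS : MeasurableSet S)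
    (hνS : ν Sᶜ = 0) : HasIndepIncrements (count (poissonPoints S)) (poissonSpaceMeasure ν) := by
  intro n τ hτ
  have hD : ∀ i : Fin n, Measurable fun ω => count (poissonPoints S) (τ i.succ) ω -
      count (poissonPoints S) (τ i.castSucc) ω := fun i =>
    (measurable_count_poissonPoints hS _).sub (measurable_count_poissonPoints hS _)
  have hcast : Measurable (Nat.cast : ℕ → ℝ) := measurable_of_countable _
  have key : iIndepFun (fun (i : Fin n) ω => ((count (poissonPoints S) (τ i.succ) ω -
      count (poissonPoints S) (τ i.castSucc) ω : ℕ) : ℝ)) (poissonSpaceMeasure ν) := by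
    refine iIndepFun_of_integral_exp_sum (fun i => hcast.comp (hD i)) fun θ => ?_
    have h1 : ∀ i : Fin n, charFun ((poissonSpaceMeasure ν).map fun ω =>
        ((count (poissonPoints S) (τ i.succ) ω -
          count (poissonPoints S) (τ i.castSucc) ω : ℕ) : ℝ)) (θ i) =
        Complex.exp (ν.real (Ioc (τ i.castSucc : ℝ) (τ i.succ)) *
          (Complex.exp (θ i * Complex.I) - 1)) := by
      intro i
      have := map_count_poissonPoints ν hS hνS (hτ (Fin.castSucc_lt_succ (i := i)).le)
      rw [← Function.comp_def Nat.cast, ← Measure.map_map hcast (hD i), this,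
        charFun_map_cast_poissonMeasure, Real.coe_toNNReal _ measureReal_nonneg]
    have h2 := charFun_count_poissonPoints ν hνS hτ θ
    push_cast at h2
    push_cast
    rw [h2, Complex.exp_sum]
    exact Finset.prod_congr rfl fun i _ => (h1 i).symm
  have h3 := key.comp (fun _ => Nat.floor) fun _ => Nat.measurable_floor
  simp only [Function.comp_def, Nat.floor_natCast] at h3
  exact h3

theorem finite_poissonPoints_inter_Ioc (S : Set ℝ) (ω : PoissonSpace) (T : ℝ) :
    (poissonPoints S ω ∩ Ioc 0 T).Finite := by
  by_cases hω : ω ∈ goodSamples S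
  · rw [poissonPoints_inter_Ioc hω (Nat.le_ceil T)]
    exact (Finset.finite_toSet _).image _
  · simp [poissonPoints, hω]

theorem poissonPoints_subset (S : Set ℝ) (ω : PoissonSpace) : poissonPoints S ω ⊆ S ∩ Ioi 0 := by
  rintro x ⟨hω, k, j, hj, rfl⟩
  exact ⟨(hω.1 k j hj).2, (Nat.cast_nonneg k).trans_lt (hω.1 k j hj).1.1⟩

end PoissonConstruction

/-- The intensity measure of a Poisson process with rate function `r`. -/
noncomputable def intensity (r : ℝ → ℝ) : Measure ℝ :=
  volume.withDensity fun x => ENNReal.ofReal (r x)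

theorem isLocallyFiniteMeasure_intensity {r : ℝ → ℝ} (hri : LocallyIntegrable r volume) :
    IsLocallyFiniteMeasure (intensity r) := by
  refine ⟨fun x => ?_⟩
  obtain ⟨u, hu, hint⟩ := hri x
  obtain ⟨v, hvu, hv, hxv⟩ := mem_nhds_iff.1 hu
  refine ⟨v, hv.mem_nhds hxv, ?_⟩
  rw [intensity, withDensity_apply _ hv.measurableSet]
  exact (lintegral_mono_set hvu).trans_lt hint.lintegral_lt_top

/-- Poisson processes exist, and their points can be taken in the support of the rate function. -/
theorem isPoissonProcess_poissonPoints {r : ℝ → ℝ} (hr : Measurable r) (hr0 : ∀ x, 0 ≤ r x)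
    (hri : LocallyIntegrable r volume) :
    IsPoissonProcess (poissonSpaceMeasure (intensity r)) (poissonPoints (Function.support r))
      r := by
  have hfin := isLocallyFiniteMeasure_intensity hri
  have hna : NullSingletonClass (intensity r) :=
    ⟨fun x => withDensity_absolutelyContinuous _ _ (measure_singleton x)⟩
  have hS : MeasurableSet (Function.support r) := measurableSet_support hr
  have hνS : intensity r (Function.support r)ᶜ = 0 := by
    rw [intensity, withDensity_apply _ hS.compl, setLIntegral_eq_zero_iff hS.compl (by fun_prop)]
    refine Eventually.of_forall fun x hx => ?_
    simp [Function.notMem_support.1 hx]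
  refine ⟨fun ω => (poissonPoints_subset _ ω).trans inter_subset_right,
    finite_poissonPoints_inter_Ioc _, measurable_count_poissonPoints hS, fun s t hst => ?_,
    hasIndepIncrements_poissonPoints _ hS hνS⟩
  rw [map_count_poissonPoints _ hS hνS hst]
  congr 2
  rw [intervalIntegral.integral_of_le (by exact_mod_cast hst), Measure.real, intensity,
    withDensity_apply _ measurableSet_Ioc,
    integral_eq_lintegral_of_nonneg_ae (Eventually.of_forall hr0) (by fun_prop)]

/-- A Poisson process remains one on an extension of the probability space. -/
theorem IsPoissonProcess.comp_measurePreserving {Ω Ω' : Type*} [MeasurableSpace Ω]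
    [MeasurableSpace Ω'] {P : Measure Ω} {P' : Measure Ω'} {pts : Ω → Set ℝ} {r : ℝ → ℝ}
    (h : IsPoissonProcess P pts r) {f : Ω' → Ω} (hf : MeasurePreserving f P' P) :
    IsPoissonProcess P' (fun ω => pts (f ω)) r := by
  refine ⟨fun ω => h.pos _, fun ω => h.locallyFinite _,
    fun t => (h.measurable_count t).comp hf.measurable, fun s t hst => ?_, fun n τ hτ => ?_⟩
  · have hD : Measurable fun ω => count pts t ω - count pts s ω :=
      (h.measurable_count t).sub (h.measurable_count s)
    rw [← h.law s t hst, ← hf.map_eq, Measure.map_map hD hf.measurable]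
    rfl
  · have hD : ∀ i : Fin n, Measurable fun ω => count pts (τ i.succ) ω -
        count pts (τ i.castSucc) ω := fun i =>
      (h.measurable_count _).sub (h.measurable_count _)
    rw [iIndepFun_iff_measure_inter_preimage_eq_mul]
    intro S sets hsets
    have key := (iIndepFun_iff_measure_inter_preimage_eq_mul.1 (h.indep n τ hτ)) S hsets
    have h1 : ∀ i ∈ S, P' ((fun ω => count pts (τ i.succ) (f ω) -
        count pts (τ i.castSucc) (f ω)) ⁻¹' sets i) =
        P ((fun ω => count pts (τ i.succ) ω - count pts (τ i.castSucc) ω) ⁻¹' sets i) :=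
      fun i hi => hf.measure_preimage ((hD i) (hsets i hi)).nullMeasurableSet
    refine Eq.trans ?_ (key.trans (Finset.prod_congr rfl fun i hi => (h1 i hi).symm))
    rw [← hf.measure_preimage (Finset.measurableSet_biInter S fun i hi =>
      (hD i) (hsets i hi)).nullMeasurableSet]
    simp only [preimage_iInter]
    rfl

/-! ### A queue with outages whose mean peak age is below its mean age -/

/-- In each period of length `3` the arrivals take place in the first third, during which the server
is down. -/
def arrivalPhase : Set ℝ := {x | Int.fract (x / 3) < 1 / 3}

theorem measurableSet_arrivalPhase : MeasurableSet arrivalPhase :=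
  measurableSet_lt (measurable_fract.comp (measurable_id.div_const 3)) measurable_const

theorem mem_arrivalPhase_iff {x : ℝ} (hx : x ∈ Ico (0 : ℝ) 3) : x ∈ arrivalPhase ↔ x < 1 := by
  have : Int.fract (x / 3) = x / 3 := Int.fract_eq_self.2 ⟨by linarith [hx.1], by linarith [hx.2]⟩
  simp only [arrivalPhase, mem_ofPred_eq, this]
  constructor <;> intro h <;> linarith

theorem periodic_indicator_arrivalPhase (c d : ℝ) :
    Function.Periodic (fun x => arrivalPhase.indicator (fun _ => c) x +
      arrivalPhaseᶜ.indicator (fun _ => d) x) 3 := by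
  classical
  intro x
  have : Int.fract ((x + 3) / 3) = Int.fract (x / 3) := by
    rw [add_div, div_self (by norm_num : (3 : ℝ) ≠ 0), Int.fract_add_one]
  by_cases h : Int.fract (x / 3) < 1 / 3 <;>
    simp only [indicator, arrivalPhase, mem_ofPred_eq, mem_compl_iff, this, h, if_true, if_false,
      not_true_eq_false, not_false_eq_true]

/-- One class; packets are generated at rate `1` in the arrival phase, and served at rate `10`
outside of it. -/
noncomputable def outageRates : Rates 1 where
  arr _ := arrivalPhase.indicator fun _ => 1
  svc _ := arrivalPhaseᶜ.indicator fun _ => 10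
  period := 3
  period_pos := by norm_num
  arr_nonneg _ _ := indicator_nonneg (fun _ _ => zero_le_one) _
  svc_nonneg _ _ := indicator_nonneg (fun _ _ => by norm_num) _
  arr_periodic _ := by simpa using periodic_indicator_arrivalPhase 1 0
  svc_periodic _ := by simpa using periodic_indicator_arrivalPhase 0 10
  arr_integrable _ := (locallyIntegrable_const _).indicator measurableSet_arrivalPhase
  svc_integrable _ := (locallyIntegrable_const _).indicator measurableSet_arrivalPhase.compl

theorem measurable_rate_outageRates (c : Clock 1) : Measurable (outageRates.rate c) := by
  cases c
  · exact measurable_const.indicator measurableSet_arrivalPhase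
  · exact measurable_const.indicator measurableSet_arrivalPhase.compl

theorem isPoissonProcess_outage (c : Clock 1) :
    IsPoissonProcess (poissonSpaceMeasure (intensity (outageRates.rate c)))
      (poissonPoints (Function.support (outageRates.rate c))) (outageRates.rate c) := by
  refine isPoissonProcess_poissonPoints (measurable_rate_outageRates c) ?_ ?_
  · cases c
    · exact outageRates.arr_nonneg _
    · exact outageRates.svc_nonneg _
  · cases c
    · exact outageRates.arr_integrable _
    · exact outageRates.svc_integrable _

instance (c : Clock 1) : IsLocallyFiniteMeasure (intensity (outageRates.rate c)) := by
  cases c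
  · exact isLocallyFiniteMeasure_intensity (outageRates.arr_integrable _)
  · exact isLocallyFiniteMeasure_intensity (outageRates.svc_integrable _)

/-- The joint law of two independent Poisson clocks. -/
noncomputable def outageMeasure : Measure (Clock 1 → PoissonSpace) :=
  Measure.infinitePi fun c => poissonSpaceMeasure (intensity (outageRates.rate c))

instance : IsProbabilityMeasure outageMeasure := by
  unfold outageMeasure; infer_instance

theorem disjoint_support_rate {c c' : Clock 1} (h : c ≠ c') :
    Disjoint (Function.support (outageRates.rate c)) (Function.support (outageRates.rate c')) := by
  have ha : ∀ k, Function.support (outageRates.rate (.arrival k)) ⊆ arrivalPhase := fun k =>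
    support_indicator_subset
  have hs : ∀ k, Function.support (outageRates.rate (.service k)) ⊆ arrivalPhaseᶜ := fun k =>
    support_indicator_subset
  cases c with
  | arrival k =>
    cases c' with
    | arrival k' => exact absurd (congrArg _ (Subsingleton.elim k k')) h
    | service k' => exact disjoint_compl_right.mono (ha k) (hs k')
  | service k =>
    cases c' with
    | arrival k' => exact disjoint_compl_left.mono (hs k) (ha k')
    | service k' => exact absurd (congrArg _ (Subsingleton.elim k k')) h

/-- The queue starts empty; the last update delivered before time `0` was generated at time `-10`.
-/
noncomputable def outageQueue : PriorityQueue outageMeasure outageRates where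
  points c ω := poissonPoints (Function.support (outageRates.rate c)) (ω c)
  poisson c := (isPoissonProcess_outage c).comp_measurePreserving
    (measurePreserving_eval_infinitePi _ c)
  points_disjoint ω c c' h := (disjoint_support_rate h).mono
    ((poissonPoints_subset _ _).trans inter_subset_left)
    ((poissonPoints_subset _ _).trans inter_subset_left)
  init _ := .idle
  lastGen _ _ := -10
  measurable_init := measurable_const
  measurable_lastGen := measurable_const
  servGen_nonpos _ := le_rfl
  bufGen_nonpos _ _ := le_rfl
  lastGen_nonpos _ _ := by norm_num
  integrable_lastGen _ := integrable_const _
  indep_clocks := by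
    have h := iIndepFun_infinitePi
      (P := fun c => poissonSpaceMeasure (intensity (outageRates.rate c)))
      (X := fun c ω (t : ℝ≥0) => count (poissonPoints (Function.support (outageRates.rate c))) t ω)
      fun c => measurable_pi_lambda _ (isPoissonProcess_outage c).measurable_count
    exact h
  indep_init := indepFun_const_left _ _

/-- The arrival clock of the single class. -/
abbrev arrClock : Clock 1 := .arrival 0

/-- The service clock of the single class. -/
abbrev svcClock : Clock 1 := .service 0

theorem clock_one_cases (c : Clock 1) : c = arrClock ∨ c = svcClock := by
  cases c with
  | arrival k => exact Or.inl (congrArg _ (Subsingleton.elim k 0))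
  | service k => exact Or.inr (congrArg _ (Subsingleton.elim k 0))

theorem arrival_lt_one {ω : Clock 1 → PoissonSpace} {τ : ℝ}
    (h : τ ∈ outageQueue.points arrClock ω) (hτ : τ ≤ 2) : τ ∈ Ioo (0 : ℝ) 1 := by
  have h0 : 0 < τ := (poissonPoints_subset _ _ h).2
  have h1 : τ ∈ arrivalPhase := support_indicator_subset (poissonPoints_subset _ _ h).1
  exact ⟨h0, (mem_arrivalPhase_iff ⟨h0.le, by linarith⟩).1 h1⟩

theorem one_le_service {ω : Clock 1 → PoissonSpace} {τ : ℝ}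
    (h : τ ∈ outageQueue.points svcClock ω) : 1 ≤ τ := by
  have h0 : 0 < τ := (poissonPoints_subset _ _ h).2
  have h1 : τ ∈ arrivalPhaseᶜ := support_indicator_subset (poissonPoints_subset _ _ h).1
  by_contra! hlt
  exact h1 ((mem_arrivalPhase_iff ⟨h0.le, by linarith⟩).2 hlt)

/-- The number of arrivals up to time `2`. -/
noncomputable def numArr (ω : Clock 1 → PoissonSpace) : ℕ :=
  count (outageQueue.points arrClock) 2 ω

/-- The number of points of the service clock up to time `2`. -/
noncomputable def numSvc (ω : Clock 1 → PoissonSpace) : ℕ :=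
  count (outageQueue.points svcClock) 2 ω

theorem exists_point_of_count_pos {N : ℕ} {Ω : Type*} [MeasurableSpace Ω] {P : Measure Ω}
    {R : Rates N} (Q : PriorityQueue P R) {c : Clock N} {t : ℝ≥0} {ω : Ω}
    (h : 0 < count (Q.points c) t ω) : ∃ τ ∈ Q.points c ω, τ ∈ Ioc (0 : ℝ) t := by
  obtain ⟨τ, hτ⟩ := (Set.ncard_pos ((Q.poisson c).locallyFinite ω t)).1 h
  exact ⟨τ, hτ.1, hτ.2⟩

theorem count_eq_zero_iff {N : ℕ} {Ω : Type*} [MeasurableSpace Ω] {P : Measure Ω}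
    {R : Rates N} (Q : PriorityQueue P R) {c : Clock N} {t : ℝ≥0} {ω : Ω} :
    count (Q.points c) t ω = 0 ↔ ∀ τ ∈ Q.points c ω, τ ∉ Ioc (0 : ℝ) t := by
  rw [count, Set.ncard_eq_zero ((Q.poisson c).locallyFinite ω t),
    ← Set.disjoint_iff_inter_eq_empty, Set.disjoint_left]

/-- The server is serving. -/
def QState.Busy (x : QState 1) : Prop := x.serving = some 0

theorem QState.Busy.arrive {x : QState 1} (hx : x.Busy) (τ : ℝ) : (arrClock.act τ x).Busy :=
  PriorityQueue.serving_act_of_serving_eq (by simp) hx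

theorem QState.busy_arrive (x : QState 1) (τ : ℝ) : (arrClock.act τ x).Busy := by
  cases x with
  | idle => rfl
  | busy j r buf => exact congrArg some (Subsingleton.elim j 0)

theorem not_service_of_notMem {ω : Clock 1 → PoissonSpace} {c : Clock 1} {σ : ℝ} {I : Set ℝ}
    (hI : ∀ σ ∈ outageQueue.points svcClock ω, σ ∉ I) (hσ : σ ∈ outageQueue.points c ω)
    (hσI : σ ∈ I) : c = arrClock := by
  rcases clock_one_cases c with rfl | rfl
  · rfl
  · exact absurd hσI (hI σ hσ)

/-- Without service points, the server is busy from the first arrival on. -/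
theorem busy_state_of_arrival {ω : Clock 1 → PoissonSpace} {τ u : ℝ}
    (hτ : τ ∈ outageQueue.points arrClock ω) (hτu : τ ≤ u)
    (hno : ∀ σ ∈ outageQueue.points svcClock ω, σ ∉ Ioc τ u) : (outageQueue.state u ω).Busy := by
  have hτ0 : 0 < τ := (poissonPoints_subset _ _ hτ).2
  refine outageQueue.state_induction hτ0.le hτu QState.Busy ?_ fun c σ x hσ hσu hx => ?_
  · rw [outageQueue.state_eq_act_stateBefore hτ]
    exact QState.busy_arrive _ _
  · rw [not_service_of_notMem hno hσ hσu]
    exact hx.arrive σ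

theorem busy_stateBefore_of_arrival {ω : Clock 1 → PoissonSpace} {τ u : ℝ}
    (hτ : τ ∈ outageQueue.points arrClock ω) (hτu : τ < u)
    (hno : ∀ σ ∈ outageQueue.points svcClock ω, σ ∉ Ioo τ u) :
    (outageQueue.stateBefore u ω).Busy := by
  have hτ0 : 0 < τ := (poissonPoints_subset _ _ hτ).2
  refine outageQueue.stateBefore_induction hτ0.le hτu QState.Busy ?_ fun c σ x hσ hσu hx => ?_
  · rw [outageQueue.state_eq_act_stateBefore hτ]
    exact QState.busy_arrive _ _
  · rw [not_service_of_notMem hno hσ hσu]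
    exact hx.arrive σ

theorem QState.waiting_arrive_of_busy {x : QState 1} (hx : x.Busy) (τ : ℝ) :
    (arrClock.act τ x).waiting 0 = true := by
  cases x with
  | idle => simp [Busy, serving] at hx
  | busy j r buf => simp [Clock.act, QState.arrive, waiting]

theorem QState.waiting_arrive {x : QState 1} (hx : x.waiting 0 = true) (τ : ℝ) :
    (arrClock.act τ x).waiting 0 = true := by
  cases x with
  | idle => simp [waiting] at hx
  | busy j r buf => simp [Clock.act, QState.arrive, waiting]

/-- After two arrivals a packet is waiting. -/
theorem waiting_stateBefore_of_two_arrivals {ω : Clock 1 → PoissonSpace} {τ τ' u : ℝ}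
    (hτ : τ ∈ outageQueue.points arrClock ω) (hτ' : τ' ∈ outageQueue.points arrClock ω)
    (hlt : τ < τ') (hτu : τ' < u) (hno : ∀ σ ∈ outageQueue.points svcClock ω, σ ∉ Ioo τ u) :
    (outageQueue.stateBefore u ω).waiting 0 = true := by
  have hτ0 : 0 < τ := (poissonPoints_subset _ _ hτ).2
  refine outageQueue.stateBefore_induction (hτ0.trans hlt).le hτu
    (fun x => x.waiting 0 = true) ?_ fun c σ x hσ hσu hx => ?_
  · rw [outageQueue.state_eq_act_stateBefore hτ']
    refine QState.waiting_arrive_of_busy (busy_stateBefore_of_arrival hτ hlt ?_) _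
    exact fun σ hσ hσu => hno σ hσ ⟨hσu.1, hσu.2.trans hτu⟩
  · rw [not_service_of_notMem hno hσ ⟨hlt.trans hσu.1, hσu.2⟩]
    exact QState.waiting_arrive hx σ

theorem QState.busy_complete {x : QState 1} (hx : x.waiting 0 = true) (τ : ℝ) :
    (svcClock.act τ x).Busy := by
  cases x with
  | idle => simp [waiting] at hx
  | busy j r buf =>
    simp only [waiting] at hx
    have h : (Finset.univ.filter fun k => (buf k).isSome = true).Nonempty :=
      ⟨0, by simpa using hx⟩
    simp only [Clock.act, QState.complete, if_pos (Subsingleton.elim j 0), QState.startNext_eq,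
      QState.firstClass, dif_pos h, Busy, serving]
    exact congrArg some (Subsingleton.elim _ _)

/-- With an arrival and no service point the first packet is still in service at time `2`. -/
theorem inService_of_numSvc_eq_zero {ω : Clock 1 → PoissonSpace} (ha : 0 < numArr ω)
    (hs : numSvc ω = 0) : ω ∈ outageQueue.inService 0 2 := by
  obtain ⟨τ, hτ, hτ2⟩ := exists_point_of_count_pos _ ha
  refine busy_state_of_arrival hτ hτ2.2 fun σ hσ hσ2 => ?_
  exact (count_eq_zero_iff _).1 hs σ hσ ⟨hτ2.1.trans hσ2.1, hσ2.2⟩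

/-- With two arrivals and one service point the last packet is in service at time `2`. -/
theorem inService_of_numSvc_eq_one {ω : Clock 1 → PoissonSpace} (ha : 1 < numArr ω)
    (hs : numSvc ω = 1) : ω ∈ outageQueue.inService 0 2 := by
  obtain ⟨σ, hσ⟩ := Set.ncard_eq_one.1 hs
  have hσm : σ ∈ outageQueue.points svcClock ω ∩ Ioc (0 : ℝ) ((2 : ℝ≥0) : ℝ) := by
    rw [hσ]; exact mem_singleton σ
  obtain ⟨hσp, hσ0, hσ2⟩ := hσm
  have huniq : ∀ ρ ∈ outageQueue.points svcClock ω, ρ ∈ Ioc (0 : ℝ) 2 → ρ = σ := by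
    intro ρ hρ hρ2
    have : ρ ∈ outageQueue.points svcClock ω ∩ Ioc (0 : ℝ) ((2 : ℝ≥0) : ℝ) := ⟨hρ, hρ2⟩
    rwa [hσ] at this
  obtain ⟨τ₁, h₁, τ₂, h₂, hne⟩ :=
    (Set.one_lt_ncard ((outageQueue.poisson arrClock).locallyFinite ω _)).1 ha
  wlog hlt : τ₁ < τ₂ generalizing τ₁ τ₂
  · exact this τ₂ h₂ τ₁ h₁ hne.symm (lt_of_le_of_ne (not_lt.1 hlt) hne.symm)
  have hσ1 : 1 ≤ σ := one_le_service hσp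
  have hτ₂ : τ₂ < σ := (arrival_lt_one h₂.1 h₂.2.2).2.trans_le hσ1
  have hw : (outageQueue.stateBefore σ ω).waiting 0 = true := by
    refine waiting_stateBefore_of_two_arrivals h₁.1 h₂.1 hlt hτ₂ fun ρ hρ hρσ => ?_
    exact hρσ.2.ne (huniq ρ hρ ⟨h₁.2.1.trans hρσ.1, hρσ.2.le.trans hσ2⟩)
  have hb : (outageQueue.state σ ω).Busy := by
    rw [outageQueue.state_eq_act_stateBefore hσp]
    exact QState.busy_complete hw σ
  have h2 : outageQueue.state 2 ω = outageQueue.state σ ω := by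
    refine outageQueue.state_eq_of_forall_notMem hσ0.le hσ2 fun c ρ hρ hρσ => ?_
    rcases clock_one_cases c with rfl | rfl
    · exact not_lt.2 (hσ1.trans hρσ.1.le) (arrival_lt_one hρ hρσ.2).2
    · exact hρσ.1.ne' (huniq ρ hρ ⟨hσ0.trans hρσ.1, hρσ.2⟩)
  change (outageQueue.state 2 ω).Busy
  rwa [h2]

/-- Without arrivals the server stays idle. -/
theorem state_eq_idle_of_numArr_eq_zero {ω : Clock 1 → PoissonSpace} (ha : numArr ω = 0) :
    outageQueue.state 2 ω = .idle := by
  refine outageQueue.state_induction le_rfl (by norm_num) (· = .idle) (outageQueue.state_zero ω)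
    fun c σ x hσ hσu hx => ?_
  rcases clock_one_cases c with rfl | rfl
  · exact absurd hσu ((count_eq_zero_iff _).1 ha σ hσ)
  · rw [hx]; rfl

/-- Without arrivals nothing is delivered. -/
theorem age_of_numArr_eq_zero {ω : Clock 1 → PoissonSpace} (ha : numArr ω = 0) :
    outageQueue.age 0 2 ω = 12 := by
  rw [PriorityQueue.age_eq_sub_fresh,
    outageQueue.fresh_eq_of_forall_notMem le_rfl (by norm_num : (0 : ℝ) ≤ 2),
    PriorityQueue.fresh_zero]
  · change (2 : ℝ) - (-10) = 12
    norm_num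
  · intro x hx hx2
    have h2 : outageQueue.stateBefore x.2 ω = .idle := by
      refine outageQueue.stateBefore_induction le_rfl hx2.1 (· = .idle) (outageQueue.state_zero ω)
        fun c σ x hσ hσu hx => ?_
      rcases clock_one_cases c with rfl | rfl
      · exact absurd ⟨hσu.1, hσu.2.le.trans hx2.2⟩ ((count_eq_zero_iff _).1 ha σ hσ)
      · rw [hx]; rfl
    have h3 := hx.2.1
    rw [h2] at h3
    simp [QState.serving] at h3

theorem genNonneg_arrive {x : QState 1} {τ : ℝ} (hτ : 0 < τ)
    (hx : 0 ≤ x.servGen ∧ ∀ k, 0 ≤ x.bufGen k) :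
    0 ≤ (arrClock.act τ x).servGen ∧ ∀ k, 0 ≤ (arrClock.act τ x).bufGen k := by
  cases x with
  | idle => exact ⟨hτ.le, fun _ => le_rfl⟩
  | busy j r buf =>
    refine ⟨hx.1, fun k => ?_⟩
    simp only [Clock.act, QState.arrive, QState.bufGen, Function.update_apply,
      if_pos (show k = 0 from Subsingleton.elim k 0)]
    exact hτ.le

/-- With an arrival and a service point a packet generated after time `0` has been delivered. -/
theorem age_le_of_numArr_pos_of_numSvc_pos {ω : Clock 1 → PoissonSpace} (ha : 0 < numArr ω)
    (hs : 0 < numSvc ω) : outageQueue.age 0 2 ω ≤ 2 := by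
  obtain ⟨τ, hτ, hτ2⟩ := exists_point_of_count_pos _ ha
  obtain ⟨σ, ⟨hσ, hσ2⟩, hmin⟩ := Set.exists_min_image _ id
    ((outageQueue.poisson svcClock).locallyFinite ω 2) ((Set.ncard_pos
      ((outageQueue.poisson svcClock).locallyFinite ω _)).1 hs)
  have hσ1 : 1 ≤ σ := one_le_service hσ
  have hno : ∀ ρ ∈ outageQueue.points svcClock ω, ρ ∉ Ioo 0 σ := fun ρ hρ hρσ =>
    not_le.2 hρσ.2 (hmin ρ ⟨hρ, hρσ.1, hρσ.2.le.trans hσ2.2⟩)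
  have hb : (outageQueue.stateBefore σ ω).Busy :=
    busy_stateBefore_of_arrival hτ ((arrival_lt_one hτ hτ2.2).2.trans_le hσ1)
      fun ρ hρ hρσ => hno ρ hρ ⟨hτ2.1.trans hρσ.1, hρσ.2⟩
  have hg : 0 ≤ (outageQueue.stateBefore σ ω).servGen ∧
      ∀ k, 0 ≤ (outageQueue.stateBefore σ ω).bufGen k := by
    refine outageQueue.stateBefore_induction le_rfl hσ2.1
      (fun x => 0 ≤ x.servGen ∧ ∀ k, 0 ≤ x.bufGen k) ?_ fun c ρ x hρ hρσ hx => ?_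
    · rw [PriorityQueue.state_zero]
      exact ⟨le_rfl, fun _ => le_rfl⟩
    · rw [not_service_of_notMem hno hρ hρσ]
      exact genNonneg_arrive hρσ.1 hx
  have := outageQueue.le_fresh (i := 0) (t := 2) (ω := ω) (C := σ)
    (r := (outageQueue.stateBefore σ ω).servGen) hσ2.2
    (Or.inr ⟨hσ, hb, rfl⟩)
  rw [PriorityQueue.age_eq_sub_fresh]
  linarith [hg.1]

/-! ### Mean age and mean peak age in the example -/

theorem integral_eq_of_eqOn_Ioo {r : ℝ → ℝ} {a b c : ℝ} (hab : a ≤ b)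
    (h : ∀ x ∈ Ioo a b, r x = c) : ∫ x in a..b, r x = (b - a) * c := by
  rw [intervalIntegral.integral_congr_Ioo_of_le (g := fun _ => c) hab h,
    intervalIntegral.integral_const, smul_eq_mul]

theorem rate_arrClock_of_lt_one {x : ℝ} (hx : x ∈ Ioo (0 : ℝ) 1) :
    outageRates.rate arrClock x = 1 := by
  have h : x ∈ arrivalPhase := (mem_arrivalPhase_iff ⟨hx.1.le, by linarith [hx.2]⟩).2 hx.2
  change arrivalPhase.indicator (fun _ => (1 : ℝ)) x = 1
  rw [indicator_of_mem h]

theorem rate_arrClock_of_one_lt {x : ℝ} (hx : x ∈ Ioo (1 : ℝ) 3) :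
    outageRates.rate arrClock x = 0 := by
  have h : x ∉ arrivalPhase := fun h =>
    not_lt.2 hx.1.le ((mem_arrivalPhase_iff ⟨by linarith [hx.1], hx.2⟩).1 h)
  change arrivalPhase.indicator (fun _ => (1 : ℝ)) x = 0
  rw [indicator_of_notMem h]

theorem rate_svcClock_of_lt_one {x : ℝ} (hx : x ∈ Ioo (0 : ℝ) 1) :
    outageRates.rate svcClock x = 0 := by
  have h : x ∈ arrivalPhase := (mem_arrivalPhase_iff ⟨hx.1.le, by linarith [hx.2]⟩).2 hx.2
  change arrivalPhaseᶜ.indicator (fun _ => (10 : ℝ)) x = 0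
  rw [indicator_of_notMem (notMem_compl_iff.2 h)]

theorem rate_svcClock_of_one_lt {x : ℝ} (hx : x ∈ Ioo (1 : ℝ) 3) :
    outageRates.rate svcClock x = 10 := by
  have h : x ∈ arrivalPhaseᶜ := fun h =>
    not_lt.2 hx.1.le ((mem_arrivalPhase_iff ⟨by linarith [hx.1], hx.2⟩).1 h)
  change arrivalPhaseᶜ.indicator (fun _ => (10 : ℝ)) x = 10
  rw [indicator_of_mem h]

theorem integral_rate_split (c : Clock 1) : ∫ x in (0 : ℝ)..2, outageRates.rate c x =
    (∫ x in (0 : ℝ)..1, outageRates.rate c x) + ∫ x in (1 : ℝ)..2, outageRates.rate c x :=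
  (intervalIntegral.integral_add_adjacent_intervals
    (PriorityQueue.rate_intervalIntegrable c 0 1)
    (PriorityQueue.rate_intervalIntegrable c 1 2)).symm

theorem integral_rate_arrClock : ∫ x in (0 : ℝ)..2, outageRates.rate arrClock x = 1 := by
  rw [integral_rate_split, integral_eq_of_eqOn_Ioo zero_le_one fun x => rate_arrClock_of_lt_one,
    integral_eq_of_eqOn_Ioo one_le_two fun x hx =>
      rate_arrClock_of_one_lt ⟨hx.1, by linarith [hx.2]⟩]
  norm_num

theorem integral_rate_svcClock : ∫ x in (0 : ℝ)..2, outageRates.rate svcClock x = 10 := by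
  rw [integral_rate_split, integral_eq_of_eqOn_Ioo zero_le_one fun x => rate_svcClock_of_lt_one,
    integral_eq_of_eqOn_Ioo one_le_two fun x hx =>
      rate_svcClock_of_one_lt ⟨hx.1, by linarith [hx.2]⟩]
  norm_num

theorem map_count_two (c : Clock 1) : outageMeasure.map (count (outageQueue.points c) 2) =
    poissonMeasure (∫ x in (0 : ℝ)..2, outageRates.rate c x).toNNReal := by
  have h := (outageQueue.poisson c).law 0 2 zero_le
  simpa only [count_zero, Nat.sub_zero, NNReal.coe_zero, NNReal.coe_ofNat] using! h

theorem measurable_numArr : Measurable numArr := (outageQueue.poisson arrClock).measurable_count 2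

theorem measurable_numSvc : Measurable numSvc := (outageQueue.poisson svcClock).measurable_count 2

theorem indepFun_numArr_numSvc : IndepFun numArr numSvc outageMeasure :=
  (outageQueue.indep_clocks.indepFun (show arrClock ≠ svcClock by simp)).comp
    (measurable_pi_apply 2) (measurable_pi_apply 2)

theorem measurableSet_numArr_eq (n : ℕ) : MeasurableSet {ω | numArr ω = n} :=
  measurable_numArr (measurableSet_singleton n)

theorem measurableSet_numSvc_eq (n : ℕ) : MeasurableSet {ω | numSvc ω = n} :=
  measurable_numSvc (measurableSet_singleton n)

theorem measurableSet_lt_numArr (n : ℕ) : MeasurableSet {ω | numArr ω ∈ Ioi n} :=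
  measurable_numArr measurableSet_Ioi

theorem measureReal_numArr_eq (n : ℕ) :
    outageMeasure.real {ω | numArr ω = n} = Real.exp (-1) / n.factorial := by
  have h := map_measureReal_apply (μ := outageMeasure) measurable_numArr (measurableSet_singleton n)
  have hl : outageMeasure.map numArr = _ := map_count_two arrClock
  rw [hl, integral_rate_arrClock, poissonMeasure_real_singleton] at h
  refine Eq.trans h.symm ?_
  simp

theorem measureReal_numSvc_eq (n : ℕ) :
    outageMeasure.real {ω | numSvc ω = n} = Real.exp (-10) * 10 ^ n / n.factorial := by
  have h := map_measureReal_apply (μ := outageMeasure) measurable_numSvc (measurableSet_singleton n)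
  have hl : outageMeasure.map numSvc = _ := map_count_two svcClock
  rw [hl, integral_rate_svcClock, poissonMeasure_real_singleton] at h
  refine Eq.trans h.symm ?_
  simp

theorem measureReal_numArr_inter_numSvc (S : Set ℕ) (n : ℕ) :
    outageMeasure.real ({ω | numArr ω ∈ S} ∩ {ω | numSvc ω = n}) =
      outageMeasure.real {ω | numArr ω ∈ S} * outageMeasure.real {ω | numSvc ω = n} := by
  have := indepFun_numArr_numSvc.measure_inter_preimage_eq_mul S {n} (.of_discrete) (.of_discrete)
  simp only [Measure.real, ← ENNReal.toReal_mul]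
  exact congrArg ENNReal.toReal this

theorem measureReal_numArr_pos :
    outageMeasure.real {ω | numArr ω ∈ Ioi 0} = 1 - Real.exp (-1) := by
  have h : {ω | numArr ω ∈ Ioi 0} = {ω | numArr ω = 0}ᶜ := by
    ext ω; simp [Nat.pos_iff_ne_zero]
  rw [h, probReal_compl_eq_one_sub (measurableSet_numArr_eq 0),
    measureReal_numArr_eq]
  simp

theorem measureReal_one_lt_numArr :
    outageMeasure.real {ω | numArr ω ∈ Ioi 1} = 1 - 2 * Real.exp (-1) := by
  have h : {ω | numArr ω ∈ Ioi 0} = {ω | numArr ω = 1} ∪ {ω | numArr ω ∈ Ioi 1} := by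
    ext ω
    simp only [mem_Ioi, mem_ofPred_eq, mem_union]
    omega
  have h1 := measureReal_numArr_pos
  rw [h, measureReal_union ?_ (measurableSet_lt_numArr 1), measureReal_numArr_eq] at h1
  · simp only [Nat.factorial_one, Nat.cast_one, div_one] at h1
    linarith
  · exact Set.disjoint_left.2 fun ω h1 h2 => (ne_of_gt h2) h1

/-- The probability that the server is busy at time `2`, bounded below by the contributions of at
most one service point. -/
theorem le_serviceProb : Real.exp (-10) * (11 - 21 * Real.exp (-1)) ≤
    outageQueue.serviceProb 0 2 := by
  have hsub : ({ω | numArr ω ∈ Ioi 0} ∩ {ω | numSvc ω = 0}) ∪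
      ({ω | numArr ω ∈ Ioi 1} ∩ {ω | numSvc ω = 1}) ⊆ outageQueue.inService 0 2 := by
    rintro ω (⟨ha, hs⟩ | ⟨ha, hs⟩)
    · exact inService_of_numSvc_eq_zero ha hs
    · exact inService_of_numSvc_eq_one ha hs
  have h := measureReal_mono hsub (measure_ne_top outageMeasure _)
  rw [measureReal_union ?_ ((measurableSet_lt_numArr 1).inter
      (measurableSet_numSvc_eq 1)), measureReal_numArr_inter_numSvc,
    measureReal_numArr_inter_numSvc, measureReal_numArr_pos, measureReal_one_lt_numArr,
    measureReal_numSvc_eq, measureReal_numSvc_eq] at h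
  · refine le_trans (le_of_eq ?_) h
    simp only [pow_zero, pow_one, Nat.factorial_zero, Nat.factorial_one, Nat.cast_one]
    ring
  · exact Set.disjoint_left.2 fun ω h1 h2 => zero_ne_one (h1.2.symm.trans h2.2)

theorem exp_neg_one_mem_Ioo : Real.exp (-1) ∈ Ioo (1 / 3 : ℝ) (3 / 8) :=
  ⟨by linarith [Real.exp_neg_one_gt_d9], by linarith [Real.exp_neg_one_lt_d9]⟩

theorem serviceProb_pos : 0 < outageQueue.serviceProb 0 2 :=
  (mul_pos (Real.exp_pos _) (by linarith [exp_neg_one_mem_Ioo.2])).trans_le le_serviceProb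

theorem measurableSet_inService_two : MeasurableSet (outageQueue.inService 0 2) :=
  outageQueue.past_le 2 _ (by simpa using outageQueue.measurableSet_inService 0 2)

theorem integrable_age_two : Integrable (outageQueue.age 0 2) outageMeasure := by
  simpa using outageQueue.integrable_age 0 2

/-- A busy server has seen an arrival; if the service clock has had a point as well, a packet
generated after time `0` has been delivered, and otherwise the age is at most its initial value
plus `2`. -/
theorem age_le_of_inService {ω : Clock 1 → PoissonSpace} (hω : ω ∈ outageQueue.inService 0 2) :
    outageQueue.age 0 2 ω ≤
      2 + ({ω | numArr ω ∈ Ioi 0} ∩ {ω | numSvc ω = 0}).indicator (fun _ => (10 : ℝ)) ω := by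
  have ha : 0 < numArr ω := by
    refine Nat.pos_of_ne_zero fun h0 => ?_
    have h1 : (outageQueue.state 2 ω).serving = some 0 := hω
    rw [state_eq_idle_of_numArr_eq_zero h0] at h1
    simp [QState.serving] at h1
  rcases Nat.eq_zero_or_pos (numSvc ω) with hs | hs
  · rw [indicator_of_mem (show ω ∈ {ω | numArr ω ∈ Ioi 0} ∩ {ω | numSvc ω = 0} from ⟨ha, hs⟩)]
    refine (outageQueue.age_le (i := 0) zero_le_two ω).trans ?_
    change (2 : ℝ) - (-10) ≤ 2 + 10
    norm_num
  · exact (age_le_of_numArr_pos_of_numSvc_pos ha hs).trans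
      (le_add_of_nonneg_right (indicator_nonneg (fun _ _ => by norm_num) _))

/-- While class `0` is in service nothing has been delivered only if the service clock has had no
point, which is unlikely even given that the server is busy. -/
theorem setIntegral_age_inService_le :
    ∫ ω in outageQueue.inService 0 2, outageQueue.age 0 2 ω ∂outageMeasure ≤
      4 * outageQueue.serviceProb 0 2 := by
  set B := {ω | numArr ω ∈ Ioi 0} ∩ {ω | numSvc ω = 0} with hB
  have hBm : MeasurableSet B := (measurableSet_lt_numArr 0).inter (measurableSet_numSvc_eq 0)
  have hPB : outageMeasure.real B = (1 - Real.exp (-1)) * Real.exp (-10) := by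
    rw [hB, measureReal_numArr_inter_numSvc, measureReal_numArr_pos, measureReal_numSvc_eq]
    simp
  have hint : Integrable (B.indicator fun _ => (10 : ℝ)) outageMeasure :=
    (integrable_const 10).indicator hBm
  calc ∫ ω in outageQueue.inService 0 2, outageQueue.age 0 2 ω ∂outageMeasure
      ≤ ∫ ω in outageQueue.inService 0 2, (2 + B.indicator (fun _ => (10 : ℝ)) ω) ∂outageMeasure :=
        setIntegral_mono_on integrable_age_two.integrableOn
          ((integrable_const 2).add hint).integrableOn measurableSet_inService_two
          fun ω => age_le_of_inService
    _ = 2 * outageQueue.serviceProb 0 2 +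
          ∫ ω in outageQueue.inService 0 2, B.indicator (fun _ => (10 : ℝ)) ω ∂outageMeasure := by
        rw [integral_add (integrable_const 2) hint.integrableOn, setIntegral_const, smul_eq_mul,
          mul_comm, PriorityQueue.serviceProb]
    _ ≤ 2 * outageQueue.serviceProb 0 2 +
          ∫ ω, B.indicator (fun _ => (10 : ℝ)) ω ∂outageMeasure := by
        refine add_le_add_right (setIntegral_le_integral hint (Eventually.of_forall fun ω => ?_)) _
        exact indicator_nonneg (fun _ _ => by norm_num) ω
    _ = 2 * outageQueue.serviceProb 0 2 +
          Real.exp (-10) * (10 * (1 - Real.exp (-1))) := by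
        rw [integral_indicator_const _ hBm, hPB, smul_eq_mul]
        ring
    _ ≤ 2 * outageQueue.serviceProb 0 2 +
          2 * (Real.exp (-10) * (11 - 21 * Real.exp (-1))) := by
        rw [mul_left_comm 2]
        refine add_le_add_right (mul_le_mul_of_nonneg_left ?_ (Real.exp_pos _).le) _
        linarith [exp_neg_one_mem_Ioo.2]
    _ ≤ 4 * outageQueue.serviceProb 0 2 := by linarith [le_serviceProb]

/-- The age is `12` when there is no arrival. -/
theorem four_lt_meanAge : 4 < outageQueue.meanAge 0 2 := by
  have h : ∫ ω in {ω | numArr ω = 0}, outageQueue.age 0 2 ω ∂outageMeasure =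
      12 * Real.exp (-1) := by
    rw [setIntegral_congr_fun (measurableSet_numArr_eq 0) fun ω hω => age_of_numArr_eq_zero hω,
      setIntegral_const, measureReal_numArr_eq, smul_eq_mul]
    simp [mul_comm]
  have h2 := setIntegral_le_integral (s := {ω | numArr ω = 0}) integrable_age_two
    (Eventually.of_forall fun ω => outageQueue.age_nonneg zero_le_two ω)
  rw [h] at h2
  rw [PriorityQueue.meanAge]
  linarith [exp_neg_one_mem_Ioo.1]

/-- A completion in `(2, u)` has positive probability: the packet in service at time `2`, if any, is
completed as soon as the service clock has a point. -/
theorem measure_completionEvent_pos {h : ℝ} (hh : 0 < h) :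
    0 < outageMeasure (outageQueue.completionEvent 0 2 (2 + h)) := by
  obtain ⟨u, hu⟩ : ∃ u : ℝ≥0, (u : ℝ) = 2 + min h 1 :=
    ⟨⟨2 + min h 1, by positivity⟩, rfl⟩
  have hmin : 0 < min h 1 := lt_min hh one_pos
  have h2u : (2 : ℝ≥0) ≤ u := by
    rw [← NNReal.coe_le_coe, hu, NNReal.coe_ofNat]
    linarith
  have hrings : 0 < outageMeasure.real (outageQueue.rings svcClock 2 u) := by
    rw [outageQueue.measureReal_rings svcClock h2u, NNReal.coe_ofNat,
      integral_eq_of_eqOn_Ioo (c := 10) (by linarith) fun x hx =>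
        rate_svcClock_of_one_lt ⟨by linarith [hx.1], by
          linarith [hx.2, min_le_right h 1]⟩, sub_pos, Real.exp_lt_one_iff]
    linarith
  have hJ := outageQueue.measurableSet_inService 0 2
  have hprod := outageQueue.setIntegral_eq_of_past h2u
    (f := (outageQueue.inService 0 (2 : ℝ≥0)).indicator fun _ => (1 : ℝ))
    (measurable_const.indicator hJ) (outageQueue.measurableSet_rings_increments svcClock h2u)
  have hJm := outageQueue.past_le 2 _ hJ
  rw [setIntegral_indicator hJm, integral_indicator_const _ hJm, setIntegral_const, smul_eq_mul,
    smul_eq_mul, mul_one, mul_one, ← measureReal_congr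
      (outageQueue.completionEvent_inter_inService_ae_eq 0 2 u)] at hprod
  rw [NNReal.coe_ofNat, hu] at hprod
  have hpos : 0 < outageMeasure.real (outageQueue.completionEvent 0 2 (2 + min h 1) ∩
      outageQueue.inService 0 2) := by
    rw [hprod]
    exact mul_pos hrings serviceProb_pos
  refine (ENNReal.toReal_pos_iff.1 hpos).1.trans_le (measure_mono ?_)
  rintro ω ⟨⟨x, hx, hx2⟩, -⟩
  exact ⟨x, hx, hx2.1, hx2.2.trans_le (by linarith [min_le_left h 1])⟩

end AgeQueue

theorem mainTheorem4 :
    (∀ (N : ℕ) (R : AgeQueue.Rates N) (Ω : Type*) [MeasurableSpace Ω] (P : Measure Ω)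
      [IsProbabilityMeasure P] (Q : AgeQueue.PriorityQueue P R) (i : Fin N) (t : ℝ), 0 < t →
      (∀ h : ℝ, 0 < h → 0 < P (Q.completionEvent i t (t + h))) →
        Integrable (Q.age i t) P ∧ Integrable (Q.ageLeft i t) P ∧
        (0 < Q.serviceProb i t → ∃ d : ℝ, Q.HasMeanPeakAge i t d) ∧
        ∀ d : ℝ, Q.HasMeanPeakAge i t d →
          d - Q.meanAge i t = (1 - Q.serviceProb i t) * (d - Q.unservedMeanAge i t)) ∧
    (∃ (N : ℕ) (R : AgeQueue.Rates N) (Ω : Type) (_ : MeasurableSpace Ω) (P : Measure Ω)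
      (_ : IsProbabilityMeasure P) (Q : AgeQueue.PriorityQueue P R) (i : Fin N) (t : ℝ),
      0 < t ∧ (∀ h : ℝ, 0 < h → 0 < P (Q.completionEvent i t (t + h))) ∧
        0 < Q.serviceProb i t ∧ ∃ d : ℝ, Q.HasMeanPeakAge i t d ∧ d < Q.meanAge i t) := by
  refine ⟨fun N R Ω _ P _ Q i t ht hE => ?_, ?_⟩
  · lift t to ℝ≥0 using ht.le
    exact ⟨Q.integrable_age i t, (Q.integrable_age i t).congr (Q.ageLeft_ae_eq_age i ht).symm,
      fun hπ => ⟨_, Q.hasMeanPeakAge i (by exact_mod_cast ht) hE hπ⟩,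
      fun d hd => Q.meanPeakAge_sub_meanAge i (by exact_mod_cast ht) hE hd⟩
  · have hpeak := AgeQueue.outageQueue.hasMeanPeakAge 0 (t := 2) (by norm_num)
      (by simpa only [NNReal.coe_ofNat] using fun h => AgeQueue.measure_completionEvent_pos)
      (by simpa only [NNReal.coe_ofNat] using AgeQueue.serviceProb_pos)
    simp only [NNReal.coe_ofNat] at hpeak
    refine ⟨1, AgeQueue.outageRates, AgeQueue.Clock 1 → AgeQueue.PoissonSpace, inferInstance,
      AgeQueue.outageMeasure, inferInstance, AgeQueue.outageQueue, 0, 2, two_pos,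
      fun h => AgeQueue.measure_completionEvent_pos, AgeQueue.serviceProb_pos, _, hpeak,
      lt_of_le_of_lt ?_ AgeQueue.four_lt_meanAge⟩
    exact (div_le_iff₀ AgeQueue.serviceProb_pos).2 AgeQueue.setIntegral_age_inService_le
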